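/- **System.** Let $\dot x=Ax+Bu$, $A\in\mathbb R^{n_x\times n_x}$, $B\in\mathbb R^{n_x\times n_u}$, $x(0)$ arbitrary, and let $K$ be such that all eigenvalues of $A+BK$ have negative real part. Let $S$ be invertible with $SAS^{-1}=\mathrm{diag}(A_1,\dots,A_p)$ in real Jordan form: $A_r$ is the Jordan block of order $n_r$ of a real eigenvalue $c_r$ (put $d_r=0$), or the real Jordan block of order $2n_r$ of a pair $c_r\pm d_r i$, $d_r\ne0$, with diagonal cells $\begin{pmatrix}c_r&-d_r\\ d_r&c_r\end{pmatrix}$ and identity cells above the diagonal. Let $E(t)=\mathrm{diag}(E_1(t),\dots,E_p(t))$ with $E_r(t)=I$ if $d_r=0$, and $E_r(t)$ block diagonal with cells $\begin{pmatrix}\cos d_rt&\sin d_rt\\-\sin d_rt&\cos d_rt\end{pmatrix}$ if $d_r\neq0$. Put $\bar x(t)=E(t)Sx(t)$, $\bar B(t)=E(t)SB$, $\bar K(t)=KS^{-1}E(t)^{-1}$ and $\bar A=\mathrm{diag}(\bar A_1,\dots,\bar A_p)$, where $\bar A_r$ is the Jordan block of order $n_r$ with eigenvalue $c_r$ if $d_r=0$,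 and the Kronecker product of that block with the $2\times2$ identity if $d_r\ne0$. **Network.** Transmissions are attempted at $t_k=k\Delta$, $k\ge0$, $\Delta>0$. A DoS signal is a finite or infinite sequence of successive, non-overlapping intervals $H_n=\{h_n\}\cup[h_n,h_n+\tau_n[$, $h_n,\tau_n\ge0$. For given $\eta,\kappa\ge0$, $\tau_D>0$, $T>1$ it is assumed that, for all $0\le\tau\le t$, the number of $h_n$ in $[\tau,t]$ is at most $\eta+\frac{t-\tau}{\tau_D}$, and $\bigcup_nH_n\cap[\tau,t]$ has length at most $\kappa+\frac{t-\tau}{T}$. The attempt at $t_k$ succeeds iff $t_k\notin\bigcup_nH_n$; $z_0<z_1<\cdots$ are the instants of success. For $a\leq b$ let $T_S(a,b)$ be the number of successes in $]a,b]$, and $T_S(a,b^-)$ the number in $]a,b[$. **Bits.** For each $r$ let $R_r\ge0$ be an integer and $w_r$ a real number with $w_r>c_r$. Put $s_0^r=z_0$ and $$s_g^r=\min\Big\{z_m>s_{g-1}^r:\ \tfrac{e^{c_r(z_m-s_{g-1}^r)}}{(2^{R_r})^{T_S(s_{g-1}^r,z_m)}}<1\Big\}\quad(g\ge1).$$ At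 an attempt $t_k\in\,]s_{g-1}^r,s_g^r]$ each element of the $r$-th block uses $$R_r(t_k)=\begin{cases}\min\{\max\{0,\lceil w_r(t_k-s_{g-1}^r)\log_2e\rceil\},R_r\}&\text{if } \frac{e^{c_r(t_k-s_{g-1}^r)}}{(2^{R_r})^{T_S(s_{g-1}^r,t_k^-)+1}}<1,\\ R_r&\text{otherwise}\end{cases}$$ bits. For $t_k\le z_0$ the numbers of bits $R_r(t_k)\in\{0,1,2,\dots\}$ are arbitrary. **Closed loop.** For $\chi\in[-1,1]$ let $q_0(\chi)=0$ and, for $R\ge1$, $q_R(\chi)=\big(\lfloor2^{R-1}\chi\rfloor+\tfrac12\big)/2^{R-1}$ if $\chi<1$, $q_R(1)=1-\tfrac12/2^{R-1}$. The input is $u(t)=\bar K(t)\hat x(t)$. The predictor $\hat x$ and the quantization range $J=(j_l)$ satisfy $\dot{\hat x}=\bar A\hat x+\bar B(t)u$, $\dot J=\bar AJ$ for $t\ne z_m$, and at $t=z_m$, for every $l$ belonging to block $r$, $$\hat x_l(t)=\hat x_l(t^-)-j_l(t^-)\,q_{R_r(t)}\Big(\tfrac{\hat x_l(t^-)-\bar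 x_l(t)}{j_l(t^-)}\Big),\qquad j_l(t)=2^{-R_r(t)}j_l(t^-),$$ with $\hat x(0^-)=0$ and $j_l(0^-)>|\bar x_l(0)|$ for all $l$. **Theorem.** Suppose $\frac1T+\frac{\Delta}{\tau_D}<1$ and, for every $r$ with $c_r\ge0$, $$R_r>\frac{1}{1-\frac1T-\frac{\Delta}{\tau_D}}\,c_r\,\Delta\log_2e .$$ Then the closed-loop system is exponentially stable: there are constants $C,\delta>0$, depending only on $A,B,K,S$, the chosen Jordan form, $\Delta,\eta,\tau_D,\kappa,T,(R_r),(w_r)$, such that for every DoS signal as above and every trajectory of the closed loop, $$\max\{\|x(t)\|,\|\hat x(t)\|,\|J(t)\|\}\le C\,e^{-\delta t}\,\big(\|x(0)\|+\|J(0^-)\|\big)\qquad\text{for all }t\ge0 .$$ -/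

import Mathlib

open Filter Topology MeasureTheory
open scoped Matrix Kronecker

noncomputable section

namespace QuantizedDoS

/-! ### Denial-of-Service signals -/

/-- A Denial-of-Service signal with `N ≤ ∞` attacks. The `n`-th attack starts (off/on transition)
at `h n ≥ 0` and lasts `τ n ≥ 0`; the attacks are ordered in time and do not overlap.
The values `h n`, `τ n` with `n ≥ N` are irrelevant. -/
structure DoS where
  N : ℕ∞
  h : ℕ → ℝ
  τ : ℕ → ℝ
  h_nonneg : ∀ n : ℕ, (n : ℕ∞) < N → 0 ≤ h n
  τ_nonneg : ∀ n : ℕ, (n : ℕ∞) < N → 0 ≤ τ n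
  h_lt : ∀ n : ℕ, ((n + 1 : ℕ) : ℕ∞) < N → h n < h (n + 1)
  h_add_le : ∀ n : ℕ, ((n + 1 : ℕ) : ℕ∞) < N → h n + τ n ≤ h (n + 1)

namespace DoS

variable (dos : DoS)

/-- The `n`-th DoS interval `{h_n} ∪ [h_n, h_n + τ_n[`. -/
def interval (n : ℕ) : Set ℝ := {dos.h n} ∪ Set.Ico (dos.h n) (dos.h n + dos.τ n)

/-- The set of all times at which the network is in DoS status. -/
def active : Set ℝ := {t | ∃ n : ℕ, (n : ℕ∞) < dos.N ∧ t ∈ dos.interval n}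

/-- The (indices of the) off/on transitions over `[a, b]`. -/
def transitions (a b : ℝ) : Set ℕ := {n | (n : ℕ∞) < dos.N ∧ dos.h n ∈ Set.Icc a b}

/-- DoS frequency: over every `[a, b]` there are at most `η + (b - a) / τ_D` transitions. -/
def FrequencyBound (η τD : ℝ) : Prop :=
  ∀ a b : ℝ, 0 ≤ a → a ≤ b →
    (dos.transitions a b).Finite ∧ ((dos.transitions a b).ncard : ℝ) ≤ η + (b - a) / τD

/-- DoS duration: over every `[a, b]` the DoS status has total length at most
`κ + (b - a) / T`. -/
def DurationBound (κ T : ℝ) : Prop :=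
  ∀ a b : ℝ, 0 ≤ a → a ≤ b →
    volume (dos.active ∩ Set.Icc a b) ≤ ENNReal.ofReal (κ + (b - a) / T)

/-- Transmission attempts take place at `t_k = k Δ`. Attempt `k` succeeds iff the network is not
in DoS status at `t_k`. -/
def Success (Δ : ℝ) (k : ℕ) : Prop := (k : ℝ) * Δ ∉ dos.active

end DoS

/-! ### Bit-computing part -/

/-- `e^{c (t_k - t_a)} / (2^R)^m`. -/
def decayRatio (Δ c : ℝ) (R a k m : ℕ) : ℝ :=
  Real.exp (c * ((k : ℝ) * Δ - (a : ℝ) * Δ)) / ((2 : ℝ) ^ R) ^ m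

/-- The index of the attempt that takes place at the instant `s_g`: `s_0` is the first successful
transmission instant `z_0`, and `s_{g+1}` is the smallest successful transmission instant
`z_m > s_g` with `e^{c (z_m - s_g)} / (2^R)^{T_S(s_g, z_m)} < 1`, where `T_S(s_g, z_m)` is the
number of successful transmissions in `]s_g, z_m]`. -/
def syncAttempt (dos : DoS) (Δ c : ℝ) (R : ℕ) : ℕ → ℕ
  | 0 => sInf {k | dos.Success Δ k}
  | g + 1 => sInf {k | syncAttempt dos Δ c R g < k ∧ dos.Success Δ k ∧
      decayRatio Δ c R (syncAttempt dos Δ c R g) k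
        {j | syncAttempt dos Δ c R g < j ∧ j ≤ k ∧ dos.Success Δ j}.ncard < 1}

/-- The number of bits determined right before attempt `k`, when the last synchronization instant
is `s = t_a`: `min {⌈w (t_k - s) log₂ e⌉, R}` if `e^{c (t_k - s)} / (2^R)^{T_S(s, t_k⁻) + 1} < 1`,
and `R` otherwise. A number of bits is a natural number, so a negative value of the
ceiling (possible only for `w < 0`) counts as `0`. -/
def bitRule (dos : DoS) (Δ c w : ℝ) (R a k : ℕ) : ℕ :=
  open Classical in
  if decayRatio Δ c R a k ({j | a < j ∧ j < k ∧ dos.Success Δ j}.ncard + 1) < 1 then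
    min ⌈w * ((k : ℝ) * Δ - (a : ℝ) * Δ) * Real.logb 2 (Real.exp 1)⌉₊ R
  else R

/-- `bits r k`, the number of bits per element of the `r`-th block at attempt `k`, follows the
time-varying bit-rate protocol. Nothing is prescribed up to and including `z_0 = s_0`. -/
def FollowsBitProtocol {p : ℕ} (dos : DoS) (Δ : ℝ) (c w : Fin p → ℝ) (R : Fin p → ℕ)
    (bits : Fin p → ℕ → ℕ) : Prop :=
  ∀ (r : Fin p) (g k : ℕ),
    syncAttempt dos Δ (c r) (R r) g < k → k ≤ syncAttempt dos Δ (c r) (R r) (g + 1) →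
      bits r k = bitRule dos Δ (c r) (w r) (R r) (syncAttempt dos Δ (c r) (R r) g) k

/-! ### The uniform quantizer -/

/-- The uniform quantizer with `R` bits; for `R ≥ 1` it is saturated to the right of `1`
(the relevant arguments lie in `[-1, 1]`). -/
def quantizer (R : ℕ) (χ : ℝ) : ℝ :=
  if R = 0 then 0
  else if χ < 1 then ((⌊(2 : ℝ) ^ (R - 1) * χ⌋ : ℝ) + 0.5) / (2 : ℝ) ^ (R - 1)
  else 1 - 0.5 / (2 : ℝ) ^ (R - 1)

/-! ### Real Jordan form and the second transformation -/

/-- The shape of a real Jordan form with `p` blocks. Block `r` belongs to the real eigenvalue `c r`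
if `d r = 0`, and to the pair `c r ± (d r) i` if `d r ≠ 0`; its order is `n r`
resp. `2 * n r`. -/
structure JordanShape (p : ℕ) where
  c : Fin p → ℝ
  d : Fin p → ℝ
  n : Fin p → ℕ
  n_pos : ∀ r, 0 < n r

namespace JordanShape

variable {p : ℕ} (F : JordanShape p)

/-- The size of the small diagonal cells of block `r`: `1` for a real eigenvalue, `2` for a
pair of complex ones. -/
def cell (r : Fin p) : ℕ := if F.d r = 0 then 1 else 2

/-- The coordinates, grouped by blocks and cells. -/
abbrev Coord : Type := Σ r : Fin p, Fin (F.n r) × Fin (F.cell r)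

/-- The nilpotent matrix with ones on the first superdiagonal. -/
def shift (n : ℕ) : Matrix (Fin n) (Fin n) ℝ :=
  Matrix.of fun i j => if (i : ℕ) + 1 = (j : ℕ) then 1 else 0

/-- `[c]` for a real eigenvalue, `[[c, -d], [d, c]]` for a complex pair. -/
def D (r : Fin p) : Matrix (Fin (F.cell r)) (Fin (F.cell r)) ℝ :=
  Matrix.of fun i j => if i = j then F.c r else if i < j then -F.d r else F.d r

/-- `[1]` for a real eigenvalue, `[[cos dt, sin dt], [-sin dt, cos dt]]` for a complex pair. -/
def rot (t : ℝ) (r : Fin p) : Matrix (Fin (F.cell r)) (Fin (F.cell r)) ℝ :=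
  Matrix.of fun i j => if i = j then Real.cos (F.d r * t)
    else if i < j then Real.sin (F.d r * t) else -Real.sin (F.d r * t)

/-- The real Jordan form `diag(A_1, …, A_p)`. -/
def Atilde : Matrix F.Coord F.Coord ℝ :=
  Matrix.blockDiagonal' fun r =>
    (1 : Matrix (Fin (F.n r)) (Fin (F.n r)) ℝ) ⊗ₖ F.D r +
      shift (F.n r) ⊗ₖ (1 : Matrix (Fin (F.cell r)) (Fin (F.cell r)) ℝ)

/-- The time-varying transformation `E(t)`. -/
def E (t : ℝ) : Matrix F.Coord F.Coord ℝ :=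
  Matrix.blockDiagonal' fun r =>
    (1 : Matrix (Fin (F.n r)) (Fin (F.n r)) ℝ) ⊗ₖ F.rot t r

/-- `Ā = E A~ E⁻¹ + E' E⁻¹`: every block is the Jordan block of `c r`, tensored with the
identity of the cell. -/
def Abar : Matrix F.Coord F.Coord ℝ :=
  Matrix.blockDiagonal' fun r =>
    (F.c r • (1 : Matrix (Fin (F.n r)) (Fin (F.n r)) ℝ) + shift (F.n r)) ⊗ₖ
      (1 : Matrix (Fin (F.cell r)) (Fin (F.cell r)) ℝ)

end JordanShape

/-! ### The closed loop -/

/-- A matrix is Hurwitz: all its complex eigenvalues have negative real part. -/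
def IsHurwitz {n : ℕ} (M : Matrix (Fin n) (Fin n) ℝ) : Prop :=
  ∀ μ ∈ spectrum ℂ (M.map (algebraMap ℝ ℂ)), μ.re < 0

/-- The Euclidean norm of a real vector. -/
def enorm2 {ι : Type} [Fintype ι] (v : ι → ℝ) : ℝ := ‖WithLp.toLp 2 v‖

variable {nx nu p : ℕ}

/-- `x̄(t) = E(t) S x(t)`. -/
def xbar (F : JordanShape p) (S : Matrix F.Coord (Fin nx) ℝ) (x : ℝ → Fin nx → ℝ) (t : ℝ) :
    F.Coord → ℝ := (F.E t * S) *ᵥ x t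

/-- The control input `u(t) = K S⁻¹ E(t)⁻¹ x̂(t)`. -/
def controlInput (K : Matrix (Fin nu) (Fin nx) ℝ) (F : JordanShape p)
    (Sinv : Matrix (Fin nx) F.Coord ℝ) (xhat : ℝ → F.Coord → ℝ) (t : ℝ) : Fin nu → ℝ :=
  (K * Sinv * (F.E t)⁻¹) *ᵥ xhat t

/-- `(x, x̂, J)` is a trajectory on `[0, ∞[` of the closed loop consisting of the process, the
predictor and the quantization range, where attempt `k` uses `bits r k` bits for every element of
block `r`. `xhatL t` and `JL t` are the left limits `x̂(t⁻)` and `J(t⁻)`, those at `t = 0` being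
the initial conditions. `x` is continuous, `x̂` and `J` are right-continuous and jump only at the
successful transmission instants; the differential equations hold for right
derivatives at every `t ≥ 0`, which includes the starting point of each flow interval. -/
structure IsClosedLoop (A : Matrix (Fin nx) (Fin nx) ℝ) (B : Matrix (Fin nx) (Fin nu) ℝ)
    (K : Matrix (Fin nu) (Fin nx) ℝ) (F : JordanShape p)
    (S : Matrix F.Coord (Fin nx) ℝ) (Sinv : Matrix (Fin nx) F.Coord ℝ)
    (dos : DoS) (Δ : ℝ) (bits : Fin p → ℕ → ℕ)
    (x : ℝ → Fin nx → ℝ) (xhat xhatL J JL : ℝ → F.Coord → ℝ) : Prop where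
  x_cont : ContinuousOn x (Set.Ici 0)
  x_flow : ∀ t : ℝ, 0 ≤ t →
    HasDerivWithinAt x (A *ᵥ x t + B *ᵥ controlInput K F Sinv xhat t) (Set.Ici t) t
  xhat_flow : ∀ t : ℝ, 0 ≤ t →
    HasDerivWithinAt xhat (F.Abar *ᵥ xhat t + (F.E t * S * B) *ᵥ controlInput K F Sinv xhat t)
      (Set.Ici t) t
  J_flow : ∀ t : ℝ, 0 ≤ t → HasDerivWithinAt J (F.Abar *ᵥ J t) (Set.Ici t) t
  xhat_left : ∀ t : ℝ, 0 < t → Tendsto xhat (𝓝[<] t) (𝓝 (xhatL t))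
  J_left : ∀ t : ℝ, 0 < t → Tendsto J (𝓝[<] t) (𝓝 (JL t))
  xhat_init : xhatL 0 = 0
  J_init : ∀ l : F.Coord, |xbar F S x 0 l| < JL 0 l
  no_jump : ∀ t : ℝ, 0 ≤ t → (∀ k : ℕ, dos.Success Δ k → t ≠ (k : ℝ) * Δ) →
    xhat t = xhatL t ∧ J t = JL t
  xhat_jump : ∀ k : ℕ, dos.Success Δ k → ∀ l : F.Coord,
    xhat ((k : ℝ) * Δ) l = xhatL ((k : ℝ) * Δ) l -
      JL ((k : ℝ) * Δ) l * quantizer (bits l.1 k)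
        ((xhatL ((k : ℝ) * Δ) l - xbar F S x ((k : ℝ) * Δ) l) / JL ((k : ℝ) * Δ) l)
  J_jump : ∀ k : ℕ, dos.Success Δ k → ∀ l : F.Coord,
    J ((k : ℝ) * Δ) l = ((2 : ℝ) ^ bits l.1 k)⁻¹ * JL ((k : ℝ) * Δ) l

end QuantizedDoS

end

namespace QuantizedDoS

/-! ### Counting successful transmissions -/

/-! The input enters predictor and transformed plant alike, so the error `e = x̂ - x̄` obeys the
same equation `z' = Ā z` as the range `J`. The off-diagonal entries of `Ā` are nonnegative, hence
its flow preserves order and `|e| ≤ J` persists between jumps; the quantizer preserves it at jumps.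
Everything reduces to the decay of `J` (`IsClosedLoop.flow`, `IsClosedLoop.error_le_range_le`).
Weights `ε ^ i` along a Jordan chain make the nilpotent part cost only a rate `ε`, so `J` in block
`r` is bounded by a multiple of `e^{(c_r + ε) t}` times 2 to the minus received bits.

It remains to show that `e^{c t} 2^{-bits}` decays uniformly in the attack
(`exists_discounted_growth_bound`). A failed attempt either sees a new attack within the last period
or follows a period wholly under attack, so frequency and duration bounds give a success ratio of at
least `1 - 1/T - Δ/τD`, up to a constant (`DoS.card_successes_ge`). For `c ≥ 0` the rate condition
then bounds the distance between synchronizations by some `L`. In each such interval either all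
successes carry `R` bits, and a strict inequality between finitely many possible counts has a
uniform slack, or the last success alone carries bits for the faster rate `w > c`
(`margin_le_bits_of_sync`). For `c < 0` no bits are needed.

Finally `x' = (A + BK) x` plus a perturbation linear in `e`, and variation of constants transfers
the decay to `x` (`IsHurwitz.exists_perturbed_bound`). -/

theorem DoS.h_le_of_mem_interval (dos : DoS) {n : ℕ} {t : ℝ} (ht : t ∈ dos.interval n) :
    dos.h n ≤ t := by
  rcases ht with ht | ht
  · exact (Set.mem_singleton_iff.1 ht).ge
  · exact ht.1

theorem DoS.mem_active_of_le_of_lt (dos : DoS) {n : ℕ} (hn : (n : ℕ∞) < dos.N) {s t : ℝ}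
    (ht : t ∈ dos.interval n) (h1 : dos.h n ≤ s) (h2 : s < t) : s ∈ dos.active := by
  refine ⟨n, hn, Or.inr ⟨h1, ?_⟩⟩
  rcases ht with ht | ht
  · rw [Set.mem_singleton_iff] at ht
    linarith
  · exact h2.trans ht.2

theorem eq_of_mem_steps {Δ : ℝ} (hΔ : 0 < Δ) {j k : ℕ} {s : ℝ}
    (hj : ((j : ℝ) - 1) * Δ < s) (hj' : s ≤ j * Δ)
    (hk : ((k : ℝ) - 1) * Δ < s) (hk' : s ≤ k * Δ) : j = k := by
  have h1 : ((j : ℝ) - 1) < k := lt_of_mul_lt_mul_right (hj.trans_le hk') hΔ.le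
  have h2 : ((k : ℝ) - 1) < j := lt_of_mul_lt_mul_right (hk.trans_le hj') hΔ.le
  have h1' : j < k + 1 := by exact_mod_cast (by linarith : (j : ℝ) < k + 1)
  have h2' : k < j + 1 := by exact_mod_cast (by linarith : (k : ℝ) < j + 1)
  omega

/-- The failures in `]a, b]` whose attack started after the previous attempt. -/
theorem DoS.card_onset_le (dos : DoS) {Δ η τD : ℝ} (hΔ : 0 < Δ)
    (hf : dos.FrequencyBound η τD) {a b : ℕ} (hab : a ≤ b) (s : Finset ℕ)
    (hs : s ⊆ Finset.Ioc a b)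
    (hs' : ∀ k ∈ s, ∃ n : ℕ, (n : ℕ∞) < dos.N ∧ ((k : ℝ) - 1) * Δ < dos.h n ∧
      dos.h n ≤ k * Δ) :
    (s.card : ℝ) ≤ η + (b - a) * Δ / τD := by
  have hab' : (a : ℝ) * Δ ≤ b * Δ := by gcongr
  obtain ⟨hfin, hcard⟩ := hf (a * Δ) (b * Δ) (by positivity) hab'
  choose! n hnN hn1 hn2 using hs'
  have h1 : s.card ≤ hfin.toFinset.card := by
    -- Distinct attempts choose distinct onsets because the windows `](k-1)Δ, kΔ]` are disjoint; all
    -- of them lie in `[aΔ, bΔ]`.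
    refine Finset.card_le_card_of_injOn n ?_ ?_
    · intro k hk
      have hk' := Finset.mem_Ioc.1 (hs hk)
      simp only [Set.Finite.coe_toFinset]
      refine ⟨hnN k hk, ?_, (hn2 k hk).trans (by gcongr; exact hk'.2)⟩
      refine le_trans ?_ (hn1 k hk).le
      gcongr
      have : (a : ℝ) + 1 ≤ k := by exact_mod_cast hk'.1
      linarith
    · intro j hj k hk hjk
      have h3 := hn1 k hk
      have h4 := hn2 k hk
      rw [← hjk] at h3 h4
      exact eq_of_mem_steps hΔ (hn1 j hj) (hn2 j hj) h3 h4
  rw [← Set.ncard_eq_toFinset_card _ hfin] at h1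
  have h2 : (s.card : ℝ) ≤ (dos.transitions (a * Δ) (b * Δ)).ncard := by exact_mod_cast h1
  calc (s.card : ℝ) ≤ _ := h2
    _ ≤ _ := hcard
    _ = _ := by ring

/-- The failures in `]a, b]` that are preceded by a whole sampling period under attack. -/
theorem DoS.card_covered_le (dos : DoS) {Δ κ T : ℝ} (hΔ : 0 < Δ) (hκ : 0 ≤ κ) (hT : 0 < T)
    (hd : dos.DurationBound κ T) {a b : ℕ} (hab : a ≤ b) (s : Finset ℕ)
    (hs : s ⊆ Finset.Ioc a b)
    (hs' : ∀ k ∈ s, Set.Ico (((k : ℝ) - 1) * Δ) (k * Δ) ⊆ dos.active) :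
    (s.card : ℝ) ≤ κ / Δ + (b - a) / T := by
  have hab' : (a : ℝ) * Δ ≤ b * Δ := by gcongr
  have hab'' : (a : ℝ) ≤ b := by exact_mod_cast hab
  have h := hd (a * Δ) (b * Δ) (by positivity) hab'
  -- Disjoint periods of length `Δ`, all under attack: their total length `s.card * Δ` is limited by
  -- the duration bound.
  have hsub : (⋃ k ∈ s, Set.Ico (((k : ℝ) - 1) * Δ) (k * Δ)) ⊆
      dos.active ∩ Set.Icc (a * Δ) (b * Δ) := by
    intro t ht
    simp only [Set.mem_iUnion] at ht
    obtain ⟨k, hk, ht⟩ := ht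
    have hk' := Finset.mem_Ioc.1 (hs hk)
    have h1 : (a : ℝ) + 1 ≤ k := by exact_mod_cast hk'.1
    have h2 : (k : ℝ) ≤ b := by exact_mod_cast hk'.2
    refine ⟨hs' k hk ht, ?_, ?_⟩
    · refine le_trans ?_ ht.1
      gcongr
      linarith
    · refine ht.2.le.trans ?_
      gcongr
  have hdisj : (s : Set ℕ).PairwiseDisjoint
      fun k : ℕ => Set.Ico (((k : ℝ) - 1) * Δ) ((k : ℝ) * Δ) := by
    intro j _ k _ hjk
    refine Set.disjoint_left.2 fun t h1 h2 => hjk ?_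
    have e1 : ((j : ℝ) - 1) < k := lt_of_mul_lt_mul_right (h1.1.trans_lt h2.2) hΔ.le
    have e2 : ((k : ℝ) - 1) < j := lt_of_mul_lt_mul_right (h2.1.trans_lt h1.2) hΔ.le
    have e1' : j < k + 1 := by exact_mod_cast (by linarith : (j : ℝ) < k + 1)
    have e2' : k < j + 1 := by exact_mod_cast (by linarith : (k : ℝ) < j + 1)
    omega
  have hvol : volume (⋃ k ∈ s, Set.Ico (((k : ℝ) - 1) * Δ) (k * Δ)) =
      ENNReal.ofReal (s.card * Δ) := by
    rw [measure_biUnion_finset hdisj fun _ _ => measurableSet_Ico]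
    have : ∀ k ∈ s, volume (Set.Ico (((k : ℝ) - 1) * Δ) (k * Δ)) = ENNReal.ofReal Δ := by
      intro k _
      rw [Real.volume_Ico]
      ring_nf
    rw [Finset.sum_congr rfl this, Finset.sum_const, ENNReal.ofReal_mul (by positivity)]
    simp
  have h3 := (hvol ▸ measure_mono hsub).trans h
  -- `ENNReal.ofReal` truncates at zero, so returning to real numbers needs a nonnegative right-hand
  -- side.
  have h4 : 0 ≤ κ + ((b : ℝ) * Δ - a * Δ) / T := by
    have : 0 ≤ ((b : ℝ) * Δ - a * Δ) / T := div_nonneg (by linarith) hT.le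
    linarith
  have h5 := (ENNReal.ofReal_le_ofReal_iff h4).1 h3
  calc (s.card : ℝ) = s.card * Δ / Δ := by field_simp
    _ ≤ (κ + ((b : ℝ) * Δ - a * Δ) / T) / Δ := by gcongr
    _ = _ := by field_simp

open Classical in
/-- The attempts with index in `]a, b]` that succeed. -/
noncomputable def DoS.successes (dos : DoS) (Δ : ℝ) (a b : ℕ) : Finset ℕ :=
  (Finset.Ioc a b).filter fun k => dos.Success Δ k

theorem DoS.mem_successes {dos : DoS} {Δ : ℝ} {a b k : ℕ} :
    k ∈ dos.successes Δ a b ↔ a < k ∧ k ≤ b ∧ dos.Success Δ k := by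
  simp [DoS.successes, and_assoc]

theorem DoS.ncard_successes (dos : DoS) (Δ : ℝ) (a b : ℕ) :
    {j | a < j ∧ j ≤ b ∧ dos.Success Δ j}.ncard = (dos.successes Δ a b).card := by
  rw [← Set.ncard_coe_finset]
  congr 1
  ext k
  simp [DoS.mem_successes]

/-- Failures are split by whether some attack starts in `](k-1)Δ, kΔ]`. If none does, the attack
blocking attempt `k` began no later than `(k-1)Δ` and covers the whole preceding period. -/
theorem DoS.card_successes_ge (dos : DoS) {Δ η τD κ T : ℝ} (hΔ : 0 < Δ) (hκ : 0 ≤ κ)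
    (hT : 0 < T) (hf : dos.FrequencyBound η τD) (hd : dos.DurationBound κ T) {a b : ℕ}
    (hab : a ≤ b) :
    (1 - 1 / T - Δ / τD) * (b - a) - (κ / Δ + η) ≤ ((dos.successes Δ a b).card : ℝ) := by
  classical
  set P : ℕ → Prop := fun k => ∃ n : ℕ, (n : ℕ∞) < dos.N ∧ ((k : ℝ) - 1) * Δ < dos.h n ∧
      dos.h n ≤ k * Δ
  set f := (Finset.Ioc a b).filter fun k => ¬ dos.Success Δ k
  have h1 := dos.card_onset_le hΔ hf hab (f.filter P)
    ((Finset.filter_subset _ _).trans (Finset.filter_subset _ _))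
    (fun k hk => (Finset.mem_filter.1 hk).2)
  have h2 := dos.card_covered_le hΔ hκ hT hd hab (f.filter fun k => ¬ P k)
    ((Finset.filter_subset _ _).trans (Finset.filter_subset _ _)) (by
      intro k hk t ht
      obtain ⟨hk1, hk2⟩ := Finset.mem_filter.1 hk
      obtain ⟨n, hn, hkn⟩ := not_not.1 (Finset.mem_filter.1 hk1).2
      refine dos.mem_active_of_le_of_lt hn hkn (le_trans ?_ ht.1) ht.2
      by_contra hlt
      exact hk2 ⟨n, hn, not_le.1 hlt, dos.h_le_of_mem_interval hkn⟩)
  have h3 := Finset.card_filter_add_card_filter_not (s := f) P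
  have h4 := Finset.card_filter_add_card_filter_not (s := Finset.Ioc a b)
    (fun k => dos.Success Δ k)
  rw [Nat.card_Ioc] at h4
  have h3' : ((f.filter P).card : ℝ) + (f.filter fun k => ¬ P k).card = f.card := by
    exact_mod_cast h3
  have h4' : ((dos.successes Δ a b).card : ℝ) + f.card = b - a := by
    rw [← Nat.cast_sub hab]
    exact_mod_cast h4
  have h5 : ((b : ℝ) - a) * Δ / τD = Δ / τD * (b - a) := by ring
  have h6 : ((b : ℝ) - a) / T = 1 / T * (b - a) := by ring
  rw [h5] at h1
  rw [h6] at h2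
  linarith

/-! ### The number of transmitted bits -/

theorem decayRatio_lt_one_iff {Δ c : ℝ} {R a k m : ℕ} :
    decayRatio Δ c R a k m < 1 ↔ c * Δ * (k - a) < R * m * Real.log 2 := by
  have h : ((2 : ℝ) ^ R) ^ m = Real.exp (R * m * Real.log 2) := by
    rw [← pow_mul, ← Real.rpow_natCast, Real.rpow_def_of_pos (by norm_num)]
    push_cast
    ring_nf
  rw [decayRatio, h, div_lt_one (Real.exp_pos _), Real.exp_lt_exp]
  ring_nf

/-- The rate condition in natural logarithms: expansion per attempt against the guaranteed average
number of received bits. -/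
theorem rate_lt_of_bits_lt {ρ c Δ R : ℝ} (hρ : 0 < ρ)
    (hR : 1 / ρ * c * Δ * Real.logb 2 (Real.exp 1) < R) :
    c * Δ < ρ * R * Real.log 2 := by
  have hl : 0 < Real.log 2 := Real.log_pos (by norm_num)
  rw [Real.logb, Real.log_exp] at hR
  have h := mul_lt_mul_of_pos_left hR (mul_pos hρ hl)
  have e : ρ * Real.log 2 * (1 / ρ * c * Δ * (1 / Real.log 2)) = c * Δ := by
    field_simp
  rw [e] at h
  linarith

/-- Within a bounded number of attempts the ratio that triggers a synchronization
drops below one. -/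
theorem exists_sync_gap {Δ η τD κ T c : ℝ} {R : ℕ} (hΔ : 0 < Δ) (hκ : 0 ≤ κ) (hT : 0 < T)
    (hρ : 0 < 1 - 1 / T - Δ / τD) (hc : 0 ≤ c)
    (hR : c * Δ < (1 - 1 / T - Δ / τD) * R * Real.log 2) :
    ∃ L : ℕ, ∀ dos : DoS, dos.FrequencyBound η τD → dos.DurationBound κ T → ∀ a : ℕ,
      ∃ k, a < k ∧ k ≤ a + L ∧ dos.Success Δ k ∧
        decayRatio Δ c R a k (dos.successes Δ a k).card < 1 := by
  set ρ := 1 - 1 / T - Δ / τD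
  set β := κ / Δ + η
  have hl : 0 < Real.log 2 := Real.log_pos (by norm_num)
  -- `L₁` lets the surplus `ρ R log 2 - cΔ` per attempt outweigh the fixed loss `β`; `L₂` forces at
  -- least one success.
  obtain ⟨L₁, hL₁⟩ := exists_nat_gt (R * Real.log 2 * β / (ρ * R * Real.log 2 - c * Δ))
  obtain ⟨L₂, hL₂⟩ := exists_nat_gt (β / ρ)
  rw [div_lt_iff₀ (by linarith)] at hL₁
  rw [div_lt_iff₀ hρ] at hL₂
  refine ⟨max L₁ L₂, fun dos hf hd a => ?_⟩
  set L := max L₁ L₂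
  have h1 : (L₁ : ℝ) ≤ L := by exact_mod_cast le_max_left _ _
  have h2 : (L₂ : ℝ) ≤ L := by exact_mod_cast le_max_right _ _
  have hcount := dos.card_successes_ge hΔ hκ hT hf hd (Nat.le_add_right a L)
  have hcount' : ρ * L - β ≤ ((dos.successes Δ a (a + L)).card : ℝ) := by
    rwa [Nat.cast_add, add_sub_cancel_left] at hcount
  have hpos : 0 < (dos.successes Δ a (a + L)).card := by
    have : ρ * L₂ ≤ ρ * L := by gcongr
    have : (0 : ℝ) < (dos.successes Δ a (a + L)).card := by linarith
    exact_mod_cast this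
  have hne := Finset.card_pos.1 hpos
  -- The last success in `]a, a + L]` counts every success of that window, while at most `L` periods
  -- have elapsed.
  set k := (dos.successes Δ a (a + L)).max' hne
  obtain ⟨hk1, hk2, hk3⟩ := DoS.mem_successes.1 ((dos.successes Δ a (a + L)).max'_mem hne)
  have hsub : dos.successes Δ a (a + L) ⊆ dos.successes Δ a k := fun j hj => by
    obtain ⟨j1, _, j3⟩ := DoS.mem_successes.1 hj
    exact DoS.mem_successes.2 ⟨j1, Finset.le_max' _ _ hj, j3⟩
  have hle : ((dos.successes Δ a (a + L)).card : ℝ) ≤ (dos.successes Δ a k).card := by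
    exact_mod_cast Finset.card_le_card hsub
  refine ⟨k, hk1, hk2, hk3, decayRatio_lt_one_iff.2 ?_⟩
  have hkL : (k : ℝ) - a ≤ L := by
    have : (k : ℝ) ≤ a + L := by exact_mod_cast hk2
    linarith
  have h3 : (ρ * R * Real.log 2 - c * Δ) * L₁ ≤ (ρ * R * Real.log 2 - c * Δ) * L :=
    mul_le_mul_of_nonneg_left h1 (by linarith)
  calc c * Δ * (k - a) ≤ c * Δ * L := by gcongr
    _ < R * Real.log 2 * (ρ * L - β) := by linarith
    _ ≤ R * Real.log 2 * (dos.successes Δ a k).card := by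
        gcongr
        linarith
    _ = _ := by ring

open Classical in
/-- The number of bits (per element of a block) received up to and including attempt `k`. -/
noncomputable def totalBits (dos : DoS) (Δ : ℝ) (bits : ℕ → ℕ) (k : ℕ) : ℕ :=
  ∑ j ∈ Finset.range (k + 1), if dos.Success Δ j then bits j else 0

theorem totalBits_eq_add (dos : DoS) (Δ : ℝ) (bits : ℕ → ℕ) {a b : ℕ} (hab : a ≤ b) :
    totalBits dos Δ bits b =
      totalBits dos Δ bits a + ∑ j ∈ dos.successes Δ a b, bits j := by
  classical
  rw [totalBits, totalBits, DoS.successes, Finset.sum_filter, Finset.range_eq_Ico,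
    Finset.range_eq_Ico,
    ← Finset.sum_Ico_consecutive _ (Nat.zero_le (a + 1)) (Nat.succ_le_succ hab)]
  congr 1
  refine Finset.sum_congr ?_ fun _ _ => rfl
  ext j
  simp only [Finset.mem_Ico, Finset.mem_Ioc]
  omega

/-- Finitely many strict inequalities share a slack, by continuity in `θ`. Here `l` will be the
number of periods between two synchronizations and `m` the number of successes. -/
theorem exists_uniform_margin (α γ : ℝ) (L : ℕ) :
    ∃ θ : ℝ, 0 < θ ∧ ∀ l ≤ L, ∀ m ≤ L, α * (l : ℝ) < γ * (m : ℝ) →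
      (α + θ) * l ≤ γ * m := by
  have h : ∀ᶠ θ : ℝ in 𝓝[>] 0, ∀ l ∈ Set.Iic L, ∀ m ∈ Set.Iic L,
      α * (l : ℝ) < γ * (m : ℝ) → (α + θ) * l ≤ γ * m := by
    rw [Filter.eventually_all_finite (Set.finite_Iic L)]
    intro l _
    rw [Filter.eventually_all_finite (Set.finite_Iic L)]
    intro m _
    by_cases hlm : α * (l : ℝ) < γ * (m : ℝ)
    · have hc : Tendsto (fun θ : ℝ => (α + θ) * l) (𝓝[>] 0) (𝓝 ((α + 0) * l)) :=
        ((continuous_const.add continuous_id).mul continuous_const).continuousAt.mono_left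
          nhdsWithin_le_nhds
      rw [add_zero] at hc
      filter_upwards [hc.eventually (gt_mem_nhds hlm)] with θ hθ _ using hθ.le
    · exact Filter.Eventually.of_forall fun θ h => absurd h hlm
  obtain ⟨θ, hθ, hpos⟩ := (h.and self_mem_nhdsWithin).exists
  exact ⟨θ, hpos, fun l hl m hm => hθ l hl m hm⟩

section Sync

variable {dos : DoS} {Δ c : ℝ} {R L : ℕ}

theorem syncAttempt_zero_le
    (hgap : ∀ a : ℕ, ∃ k, a < k ∧ k ≤ a + L ∧ dos.Success Δ k ∧
      decayRatio Δ c R a k (dos.successes Δ a k).card < 1) :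
    syncAttempt dos Δ c R 0 ≤ L := by
  obtain ⟨k, _, hk, hs, _⟩ := hgap 0
  rw [zero_add] at hk
  exact (Nat.sInf_le hs).trans hk

theorem syncAttempt_succ_eq (dos : DoS) (Δ c : ℝ) (R g : ℕ) :
    syncAttempt dos Δ c R (g + 1) = sInf {k | syncAttempt dos Δ c R g < k ∧ dos.Success Δ k ∧
      decayRatio Δ c R (syncAttempt dos Δ c R g) k
        (dos.successes Δ (syncAttempt dos Δ c R g) k).card < 1} := by
  rw [syncAttempt]
  simp only [DoS.ncard_successes]

/-- `hgap` makes the defining set nonempty, so `sInf` is a true minimum and not the default value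
`0`. -/
theorem syncAttempt_succ_spec
    (hgap : ∀ a : ℕ, ∃ k, a < k ∧ k ≤ a + L ∧ dos.Success Δ k ∧
      decayRatio Δ c R a k (dos.successes Δ a k).card < 1) (g : ℕ) :
    syncAttempt dos Δ c R g < syncAttempt dos Δ c R (g + 1) ∧
    syncAttempt dos Δ c R (g + 1) ≤ syncAttempt dos Δ c R g + L ∧
    dos.Success Δ (syncAttempt dos Δ c R (g + 1)) ∧
    decayRatio Δ c R (syncAttempt dos Δ c R g) (syncAttempt dos Δ c R (g + 1))
      (dos.successes Δ (syncAttempt dos Δ c R g) (syncAttempt dos Δ c R (g + 1))).card < 1 ∧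
    ∀ k, syncAttempt dos Δ c R g < k → k < syncAttempt dos Δ c R (g + 1) → dos.Success Δ k →
      ¬ decayRatio Δ c R (syncAttempt dos Δ c R g) k
        (dos.successes Δ (syncAttempt dos Δ c R g) k).card < 1 := by
  set a := syncAttempt dos Δ c R g with ha
  obtain ⟨k, hk1, hk2, hk3, hk4⟩ := hgap a
  have hmem : k ∈ {k | a < k ∧ dos.Success Δ k ∧
      decayRatio Δ c R a k (dos.successes Δ a k).card < 1} := ⟨hk1, hk3, hk4⟩
  have hs := Nat.sInf_mem ⟨k, hmem⟩
  rw [ha, ← syncAttempt_succ_eq, ← ha] at hs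
  refine ⟨hs.1, ?_, hs.2.1, hs.2.2, fun j hj1 hj2 hj3 hj4 => ?_⟩
  · rw [syncAttempt_succ_eq, ← ha]
    exact (Nat.sInf_le hmem).trans hk2
  · rw [syncAttempt_succ_eq, ← ha] at hj2
    exact Nat.notMem_of_lt_sInf hj2 ⟨hj1, hj3, hj4⟩

/-- At a success `k`, the count over `]a, k[` plus one is the count over `]a, k]`. The test of the
bit rule is therefore the synchronization test itself. -/
theorem bitRule_of_success (w : ℝ) {a k : ℕ} (hak : a < k) (hk : dos.Success Δ k) :
    bitRule dos Δ c w R a k = open Classical in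
      if decayRatio Δ c R a k (dos.successes Δ a k).card < 1 then
        min ⌈w * ((k : ℝ) * Δ - (a : ℝ) * Δ) * Real.logb 2 (Real.exp 1)⌉₊ R
      else R := by
  have h : {j | a < j ∧ j < k ∧ dos.Success Δ j}.ncard + 1 = (dos.successes Δ a k).card := by
    rw [← DoS.ncard_successes]
    have hfin : {j | a < j ∧ j < k ∧ dos.Success Δ j}.Finite :=
      (Set.finite_Iio k).subset fun j hj => hj.2.1
    rw [← Set.ncard_insert_of_notMem (a := k) (fun h => lt_irrefl _ h.2.1) hfin]
    congr 1
    ext j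
    simp only [Set.mem_insert_iff, Set.mem_ofPred_eq]
    constructor
    · rintro (rfl | ⟨h1, h2, h3⟩)
      · exact ⟨hak, le_rfl, hk⟩
      · exact ⟨h1, h2.le, h3⟩
    · rintro ⟨h1, h2, h3⟩
      rcases h2.eq_or_lt with h2 | h2
      · exact Or.inl h2
      · exact Or.inr ⟨h1, h2, h3⟩
  rw [bitRule, h]

/-- Between two synchronization instants the received bits beat the expansion of the block,
with a margin proportional to the elapsed time. -/
theorem margin_le_bits_of_sync {w θ : ℝ} (hΔ : 0 < Δ)
    (hgap : ∀ a : ℕ, ∃ k, a < k ∧ k ≤ a + L ∧ dos.Success Δ k ∧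
      decayRatio Δ c R a k (dos.successes Δ a k).card < 1)
    (hθ : ∀ l ≤ L, ∀ m ≤ L, c * Δ * (l : ℝ) < R * Real.log 2 * (m : ℝ) →
      (c * Δ + θ) * l ≤ R * Real.log 2 * m)
    (hθw : θ ≤ (w - c) * Δ) {bits : ℕ → ℕ} {g : ℕ}
    (hb : ∀ k, syncAttempt dos Δ c R g < k → k ≤ syncAttempt dos Δ c R (g + 1) →
      bits k = bitRule dos Δ c w R (syncAttempt dos Δ c R g) k) :
    (c * Δ + θ) * ((syncAttempt dos Δ c R (g + 1) : ℝ) - syncAttempt dos Δ c R g) ≤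
      Real.log 2 * ((∑ j ∈ dos.successes Δ (syncAttempt dos Δ c R g)
        (syncAttempt dos Δ c R (g + 1)), bits j : ℕ) : ℝ) := by
  obtain ⟨h1, h2, h3, h4, h5⟩ := syncAttempt_succ_spec hgap g
  set a := syncAttempt dos Δ c R g
  set b := syncAttempt dos Δ c R (g + 1)
  have hl : 0 < Real.log 2 := Real.log_pos (by norm_num)
  have hbS : b ∈ dos.successes Δ a b := DoS.mem_successes.2 ⟨h1, le_rfl, h3⟩
  -- By minimality of `b` no earlier success passes the test, so only `b` itself can carry fewer
  -- than `R` bits.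
  have hbits : ∀ j ∈ (dos.successes Δ a b).erase b, bits j = R := by
    intro j hj
    obtain ⟨hjb, hj⟩ := Finset.mem_erase.1 hj
    obtain ⟨j1, j2, j3⟩ := DoS.mem_successes.1 hj
    rw [hb j j1 j2, bitRule_of_success w j1 j3, if_neg (h5 j j1 (lt_of_le_of_ne j2 hjb) j3)]
  have hbb : bits b = min ⌈w * ((b : ℝ) * Δ - (a : ℝ) * Δ) * Real.logb 2 (Real.exp 1)⌉₊ R := by
    rw [hb b h1 le_rfl, bitRule_of_success w h1 h3, if_pos h4]
  have hab : (a : ℝ) < b := by exact_mod_cast h1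
  -- If the minimum is `R`, all successes carry `R` bits and `hθ` gives the margin. Otherwise the
  -- ceiling at `b` alone pays for growth at rate `w`.
  rcases le_total R ⌈w * ((b : ℝ) * Δ - (a : ℝ) * Δ) * Real.logb 2 (Real.exp 1)⌉₊ with hc | hc
  · rw [min_eq_right hc] at hbb
    have hall : ∀ j ∈ dos.successes Δ a b, bits j = R := by
      intro j hj
      by_cases hjb : j = b
      · rw [hjb, hbb]
      · exact hbits j (Finset.mem_erase.2 ⟨hjb, hj⟩)
    rw [Finset.sum_congr rfl hall, Finset.sum_const, smul_eq_mul]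
    have hcard : (dos.successes Δ a b).card ≤ b - a := by
      classical
      rw [← Nat.card_Ioc]
      exact Finset.card_le_card (Finset.filter_subset _ _)
    have hm := hθ (b - a) (by omega) (dos.successes Δ a b).card (by omega) (by
      rw [Nat.cast_sub h1.le]
      have := decayRatio_lt_one_iff.1 h4
      linarith)
    rw [Nat.cast_sub h1.le] at hm
    push_cast
    linarith
  · rw [min_eq_left hc] at hbb
    have hceil := Nat.le_ceil (w * ((b : ℝ) * Δ - (a : ℝ) * Δ) * Real.logb 2 (Real.exp 1))
    rw [← hbb] at hceil
    have hsum : (bits b : ℝ) ≤ ((∑ j ∈ dos.successes Δ a b, bits j : ℕ) : ℝ) := by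
      exact_mod_cast Finset.single_le_sum (f := bits) (fun _ _ => Nat.zero_le _) hbS
    have h6 := mul_le_mul_of_nonneg_left (hceil.trans hsum) hl.le
    have h7 : Real.log 2 * (w * ((b : ℝ) * Δ - (a : ℝ) * Δ) * Real.logb 2 (Real.exp 1)) =
        w * Δ * (b - a) := by
      rw [Real.logb, Real.log_exp]
      field_simp
    rw [h7] at h6
    have h8 : (c * Δ + θ) * ((b : ℝ) - a) ≤ w * Δ * (b - a) :=
      mul_le_mul_of_nonneg_right (by linarith) (by linarith)
    linarith

theorem le_syncAttempt
    (hgap : ∀ a : ℕ, ∃ k, a < k ∧ k ≤ a + L ∧ dos.Success Δ k ∧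
      decayRatio Δ c R a k (dos.successes Δ a k).card < 1) (g : ℕ) :
    g ≤ syncAttempt dos Δ c R g := by
  induction g with
  | zero => exact Nat.zero_le _
  | succ g ih => exact Nat.succ_le_of_lt (ih.trans_lt (syncAttempt_succ_spec hgap g).1)

/-- The margins telescope over synchronization instants. The loss `2 * (c * Δ + θ) * L` covers the
attempts before `s_0` and those since the last synchronization, at most `L` each. -/
theorem margin_le_totalBits {w θ : ℝ} (hΔ : 0 < Δ) (hc : 0 ≤ c) (hθ0 : 0 < θ)
    (hgap : ∀ a : ℕ, ∃ k, a < k ∧ k ≤ a + L ∧ dos.Success Δ k ∧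
      decayRatio Δ c R a k (dos.successes Δ a k).card < 1)
    (hθ : ∀ l ≤ L, ∀ m ≤ L, c * Δ * (l : ℝ) < R * Real.log 2 * (m : ℝ) →
      (c * Δ + θ) * l ≤ R * Real.log 2 * m)
    (hθw : θ ≤ (w - c) * Δ) {bits : ℕ → ℕ}
    (hb : ∀ g k, syncAttempt dos Δ c R g < k → k ≤ syncAttempt dos Δ c R (g + 1) →
      bits k = bitRule dos Δ c w R (syncAttempt dos Δ c R g) k) (k : ℕ) :
    (c * Δ + θ) * k ≤ 2 * (c * Δ + θ) * L + Real.log 2 * (totalBits dos Δ bits k : ℝ) := by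
  have hl : 0 < Real.log 2 := Real.log_pos (by norm_num)
  have hα : 0 < c * Δ + θ := by positivity
  have hσ : ∀ g, (c * Δ + θ) * ((syncAttempt dos Δ c R g : ℝ) - syncAttempt dos Δ c R 0) ≤
      Real.log 2 * (totalBits dos Δ bits (syncAttempt dos Δ c R g) : ℝ) := by
    intro g
    induction g with
    | zero => simpa using mul_nonneg hl.le (Nat.cast_nonneg _)
    | succ g ih =>
      have h := margin_le_bits_of_sync hΔ hgap hθ hθw (hb g)
      rw [totalBits_eq_add dos Δ bits (syncAttempt_succ_spec hgap g).1.le, Nat.cast_add]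
      linarith
  have h0 : (syncAttempt dos Δ c R 0 : ℝ) ≤ L := by exact_mod_cast syncAttempt_zero_le hgap
  by_cases hk : k < syncAttempt dos Δ c R 0
  · have hk' : (k : ℝ) ≤ L := (by exact_mod_cast hk.le : (k : ℝ) ≤ _).trans h0
    have h1 := mul_le_mul_of_nonneg_left hk' hα.le
    have h2 : 0 ≤ Real.log 2 * (totalBits dos Δ bits k : ℝ) := by positivity
    have h3 : 0 ≤ (c * Δ + θ) * L := by positivity
    linarith
  · classical
    -- The least such index is positive, so `k` lies between consecutive synchronizations `g` and `g
    -- + 1`.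
    have hex : ∃ g, k < syncAttempt dos Δ c R g :=
      ⟨k + 1, le_syncAttempt hgap (k + 1)⟩
    obtain ⟨g, hg⟩ : ∃ g, Nat.find hex = g + 1 :=
      Nat.exists_eq_succ_of_ne_zero fun h => hk (h ▸ Nat.find_spec hex)
    have hlt : k < syncAttempt dos Δ c R (g + 1) := hg ▸ Nat.find_spec hex
    have hge : syncAttempt dos Δ c R g ≤ k :=
      not_lt.1 (Nat.find_min hex (by omega : g < Nat.find hex))
    have hL : (k : ℝ) ≤ syncAttempt dos Δ c R g + L := by
      exact_mod_cast hlt.le.trans (syncAttempt_succ_spec hgap g).2.1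
    have hmono : (totalBits dos Δ bits (syncAttempt dos Δ c R g) : ℝ) ≤
        totalBits dos Δ bits k := by
      rw [totalBits_eq_add dos Δ bits hge]
      push_cast
      exact le_add_of_nonneg_right (by positivity)
    have h1 := mul_le_mul_of_nonneg_left hL hα.le
    have h2 := mul_le_mul_of_nonneg_left h0 hα.le
    have h3 := mul_le_mul_of_nonneg_left hmono hl.le
    have h4 := hσ g
    linarith

end Sync

/-- The expansion of a block, discounted by the received bits, decays exponentially, uniformly in
the attack signal. -/
theorem exists_discounted_growth_bound {Δ η τD κ T c w : ℝ} {R : ℕ} (hΔ : 0 < Δ) (hκ : 0 ≤ κ)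
    (hT : 0 < T) (hρ : 0 < 1 - 1 / T - Δ / τD)
    (hR : 0 ≤ c → 1 / (1 - 1 / T - Δ / τD) * c * Δ * Real.logb 2 (Real.exp 1) < R)
    (hw : c < w) :
    ∃ C μ : ℝ, 0 < C ∧ 0 < μ ∧ ∀ dos : DoS, dos.FrequencyBound η τD → dos.DurationBound κ T →
      ∀ bits : ℕ → ℕ,
      (∀ g k, syncAttempt dos Δ c R g < k → k ≤ syncAttempt dos Δ c R (g + 1) →
        bits k = bitRule dos Δ c w R (syncAttempt dos Δ c R g) k) →
      ∀ (k : ℕ) (t : ℝ), k * Δ ≤ t → t ≤ (k + 1) * Δ →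
        Real.exp (c * t) * ((2 : ℝ) ^ totalBits dos Δ bits k)⁻¹ ≤ C * Real.exp (-μ * t) := by
  rcases lt_or_ge c 0 with hc | hc
  -- A contracting block decays by itself; the factor from the bits is at most one.
  · refine ⟨1, -c, one_pos, by linarith, fun dos _ _ bits _ k t _ _ => ?_⟩
    rw [neg_neg, one_mul]
    refine mul_le_of_le_one_right (Real.exp_pos _).le (inv_le_one_of_one_le₀ ?_)
    exact one_le_pow₀ (by norm_num)
  · obtain ⟨L, hL⟩ := exists_sync_gap (η := η) hΔ hκ hT hρ hc (rate_lt_of_bits_lt hρ (hR hc))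
    obtain ⟨θ₁, hθ₁, hm⟩ := exists_uniform_margin (c * Δ) (R * Real.log 2) L
    set θ := min θ₁ ((w - c) * Δ)
    have hθ : 0 < θ := lt_min hθ₁ (mul_pos (by linarith) hΔ)
    -- The extra summand `c * Δ + θ` pays for the time from `kΔ` to `t ≤ (k + 1)Δ`.
    refine ⟨Real.exp (2 * (c * Δ + θ) * L + (c * Δ + θ)), θ / Δ, Real.exp_pos _, by positivity,
      fun dos hf hd bits hb k t ht1 ht2 => ?_⟩
    have h := margin_le_totalBits hΔ hc hθ (hL dos hf hd) (fun l hl m hm' hlm =>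
      le_trans (by gcongr; exact min_le_left _ _) (hm l hl m hm' hlm)) (min_le_right _ _) hb k
    have h2 : ((2 : ℝ) ^ totalBits dos Δ bits k)⁻¹ =
        Real.exp (-(Real.log 2 * totalBits dos Δ bits k)) := by
      rw [Real.exp_neg, ← Real.rpow_natCast, Real.rpow_def_of_pos (by norm_num)]
    rw [h2, ← Real.exp_add, ← Real.exp_add, Real.exp_le_exp]
    have h3 : (c + θ / Δ) * t ≤ (c + θ / Δ) * ((k + 1) * Δ) := by gcongr
    have h4 : (c + θ / Δ) * ((k + 1) * Δ) = (c * Δ + θ) * k + (c * Δ + θ) := by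
      field_simp
    linarith

/-! ### The quantizer -/

/-- The output is the midpoint of a cell of length `2 / 2 ^ R` containing `χ`; saturation puts `χ =
1` into the last cell. -/
theorem abs_sub_quantizer_le (R : ℕ) {χ : ℝ} (hχ : |χ| ≤ 1) :
    |χ - quantizer R χ| ≤ ((2 : ℝ) ^ R)⁻¹ := by
  rcases Nat.eq_zero_or_pos R with rfl | hR
  · simpa [quantizer] using hχ
  · obtain ⟨m, rfl⟩ : ∃ m, R = m + 1 := ⟨R - 1, by omega⟩
    have hp : (0 : ℝ) < 2 ^ m := by positivity
    have hR' : ((2 : ℝ) ^ (m + 1))⁻¹ = (1 / 2) / 2 ^ m := by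
      rw [pow_succ]
      field_simp
    rw [quantizer, if_neg (by omega), Nat.add_sub_cancel, hR']
    split_ifs with h
    · have e : χ - ((⌊(2 : ℝ) ^ m * χ⌋ : ℝ) + 0.5) / 2 ^ m =
          (Int.fract ((2 : ℝ) ^ m * χ) - 1 / 2) / 2 ^ m := by
        rw [Int.fract]
        field_simp
        ring
      rw [e, abs_div, abs_of_pos hp]
      gcongr
      rw [abs_le]
      constructor <;> linarith [Int.fract_nonneg ((2 : ℝ) ^ m * χ),
        Int.fract_lt_one ((2 : ℝ) ^ m * χ)]
    · have hχ1 : χ = 1 := le_antisymm (abs_le.1 hχ).2 (not_lt.1 h)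
      rw [hχ1, sub_sub_cancel, abs_of_nonneg (by positivity)]
      norm_num

theorem abs_sub_mul_quantizer_le (R : ℕ) {e j : ℝ} (he : |e| ≤ j) :
    |e - j * quantizer R (e / j)| ≤ ((2 : ℝ) ^ R)⁻¹ * j := by
  -- A vanishing range forces `e = 0`, so the value of the division by zero is irrelevant.
  rcases ((abs_nonneg e).trans he).eq_or_lt with hj | hj
  · subst hj
    simpa using he
  · have h := abs_sub_quantizer_le R (χ := e / j) (by
      rw [abs_div, abs_of_pos hj]
      exact div_le_one_of_le₀ he hj.le)
    have e1 : e - j * quantizer R (e / j) = (e / j - quantizer R (e / j)) * j := by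
      field_simp
    rw [e1, abs_mul, abs_of_pos hj]
    gcongr

/-! ### Comparison for the transformed dynamics -/

/-- A flow between two instants, extended to the right end point by the left limit there. -/
theorem update_left_limit {V : Type*} [NormedAddCommGroup V] [NormedSpace ℝ V]
    {f f' fL : ℝ → V} {a b : ℝ}
    (hr : ∀ t ∈ Set.Ico a b, HasDerivWithinAt f (f' t) (Set.Ici t) t)
    (hl : ∀ t ∈ Set.Ioc a b, Tendsto f (𝓝[<] t) (𝓝 (fL t)))
    (hj : ∀ t ∈ Set.Ioo a b, f t = fL t) :
    ContinuousOn (Function.update f b (fL b)) (Set.Icc a b) ∧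
      ∀ t ∈ Set.Ico a b, HasDerivWithinAt (Function.update f b (fL b)) (f' t) (Set.Ici t) t := by
  have hd : ∀ t ∈ Set.Ico a b,
      HasDerivWithinAt (Function.update f b (fL b)) (f' t) (Set.Ici t) t := by
    intro t ht
    refine (hr t ht).congr_of_eventuallyEq ?_ (Function.update_of_ne ht.2.ne _ _)
    filter_upwards [mem_nhdsWithin_of_mem_nhds (Iio_mem_nhds ht.2)] with s hs
    exact Function.update_of_ne (ne_of_lt hs) _ _
  refine ⟨fun t ht => ?_, hd⟩
  have hleft : a < t → ContinuousWithinAt (Function.update f b (fL b)) (Set.Iio t) t := by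
    intro hat
    have hval : Function.update f b (fL b) t = fL t := by
      rcases ht.2.eq_or_lt with rfl | htb
      · exact Function.update_self _ _ _
      · rw [Function.update_of_ne htb.ne, hj t ⟨hat, htb⟩]
    rw [ContinuousWithinAt, hval]
    refine (hl t ⟨hat, ht.2⟩).congr' ?_
    filter_upwards [self_mem_nhdsWithin] with s hs
    exact (Function.update_of_ne (ne_of_lt (lt_of_lt_of_le hs ht.2)) _ _).symm
  rcases ht.1.eq_or_lt with rfl | hat
  · rcases ht.2.eq_or_lt with rfl | htb
    · simp
    · exact (hd _ ⟨le_rfl, htb⟩).continuousWithinAt.mono Set.Icc_subset_Ici_self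
  · rcases ht.2.eq_or_lt with rfl | htb
    · refine ((continuousWithinAt_insert_self.2 (hleft hat))).mono fun s hs => ?_
      rcases hs.2.eq_or_lt with rfl | h
      · exact Set.mem_insert _ _
      · exact Set.mem_insert_of_mem _ h
    · refine ContinuousAt.continuousWithinAt ?_
      refine continuousAt_iff_continuous_left_right.2 ⟨?_, ?_⟩
      · rw [← Set.Iio_insert]
        exact continuousWithinAt_insert_self.2 (hleft hat)
      · exact (hd t ⟨ht.1, htb⟩).continuousWithinAt

/-- The function `e^{-ct} f` has nonnegative right derivative, hence stays above its initial value's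
lower bound `0`. -/
theorem nonneg_of_deriv_right_ge {f f' : ℝ → ℝ} {a b c : ℝ} (hf : ContinuousOn f (Set.Icc a b))
    (hf' : ∀ t ∈ Set.Ico a b, HasDerivWithinAt f (f' t) (Set.Ici t) t)
    (hge : ∀ t ∈ Set.Ico a b, c * f t ≤ f' t) (h0 : 0 ≤ f a) :
    ∀ t ∈ Set.Icc a b, 0 ≤ f t := by
  have hE : ∀ t, HasDerivAt (fun t => Real.exp (-c * t)) (Real.exp (-c * t) * (-c)) t := by
    intro t
    simpa using ((hasDerivAt_id t).const_mul (-c)).exp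
  have key := image_le_of_deriv_right_le_deriv_boundary (f := fun _ => (0 : ℝ))
    (f' := fun _ => 0) (a := a) (b := b) continuousOn_const
    (fun t _ => hasDerivWithinAt_const _ _ _)
    (B := fun t => Real.exp (-c * t) * f t)
    (B' := fun t => Real.exp (-c * t) * (-c) * f t + Real.exp (-c * t) * f' t)
    (mul_nonneg (Real.exp_pos _).le h0)
    ((Continuous.continuousOn (by fun_prop)).mul hf)
    (fun t ht => (hE t).hasDerivWithinAt.mul (hf' t ht))
    (fun t ht => by
      have h1 := hge t ht
      have : Real.exp (-c * t) * (-c) * f t + Real.exp (-c * t) * f' t =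
        Real.exp (-c * t) * (f' t - c * f t) := by ring
      rw [this]
      exact mul_nonneg (Real.exp_pos _).le (by linarith))
  intro t ht
  exact (mul_nonneg_iff_of_pos_left (Real.exp_pos _)).1 (key ht)

namespace JordanShape

variable {p : ℕ} (F : JordanShape p)

theorem Abar_mulVec_apply (v : F.Coord → ℝ) (r : Fin p) (i : Fin (F.n r))
    (s : Fin (F.cell r)) :
    (F.Abar *ᵥ v) ⟨r, i, s⟩ = F.c r * v ⟨r, i, s⟩ +
      if h : (i : ℕ) + 1 < F.n r then v ⟨r, ⟨i + 1, h⟩, s⟩ else 0 := by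
  rw [Matrix.mulVec, dotProduct, Fintype.sum_sigma, Fintype.sum_eq_single r]
  · simp only [Abar, Matrix.blockDiagonal'_apply_eq, Matrix.kronecker_apply, Fintype.sum_prod_type,
      Matrix.one_apply, mul_ite, mul_one, mul_zero, ite_mul, zero_mul, Finset.sum_ite_eq,
      Finset.mem_univ, if_true, Matrix.add_apply, Matrix.smul_apply, smul_eq_mul, add_mul,
      Finset.sum_add_distrib]
    congr 1
    split_ifs with h
    · rw [Fintype.sum_eq_single (⟨i + 1, h⟩ : Fin (F.n r))]
      · simp [shift]
      · intro j hj
        have : (i : ℕ) + 1 ≠ j := fun h' => hj (Fin.ext h'.symm)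
        simp [shift, this]
    · refine Finset.sum_eq_zero fun j _ => ?_
      have : (i : ℕ) + 1 ≠ j := by
        have := j.2
        omega
      simp [shift, this]
  · intro r' hr'
    refine Finset.sum_eq_zero fun q _ => ?_
    rw [Abar, Matrix.blockDiagonal'_apply_ne _ _ _ (Ne.symm hr'), zero_mul]

/-- Supersolutions of `z' = Ā z` that start nonnegative stay nonnegative. -/
theorem nonneg_of_deriv_ge_Abar {z z' : ℝ → F.Coord → ℝ} {a b : ℝ}
    (hz : ContinuousOn z (Set.Icc a b))
    (hz' : ∀ t ∈ Set.Ico a b, HasDerivWithinAt z (z' t) (Set.Ici t) t)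
    (hge : ∀ t ∈ Set.Ico a b, ∀ l, (F.Abar *ᵥ z t) l ≤ z' t l) (h0 : ∀ l, 0 ≤ z a l) :
    ∀ t ∈ Set.Icc a b, ∀ l, 0 ≤ z t l := by
  -- Induction up the Jordan chain from its last coordinate: each coordinate obeys a scalar
  -- inequality driven by the next one, already known to be nonnegative.
  have key : ∀ (m : ℕ) (r : Fin p) (i : Fin (F.n r)) (s : Fin (F.cell r)), F.n r ≤ i + m →
      ∀ t ∈ Set.Icc a b, 0 ≤ z t ⟨r, i, s⟩ := by
    intro m
    induction m with
    | zero =>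
      intro r i s h
      have := i.2
      omega
    | succ m ih =>
      intro r i s h
      refine nonneg_of_deriv_right_ge (f := fun t => z t ⟨r, i, s⟩)
        (f' := fun t => z' t ⟨r, i, s⟩) (c := F.c r) (continuousOn_pi.1 hz _)
        (fun t ht => hasDerivWithinAt_pi.1 (hz' t ht) _) (fun t ht => ?_) (h0 _)
      have h1 := hge t ht ⟨r, i, s⟩
      rw [Abar_mulVec_apply] at h1
      split_ifs at h1 with hi
      · have h2 := ih r ⟨i + 1, hi⟩ s (by simp only; omega) t ⟨ht.1, ht.2.le⟩
        linarith
      · linarith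
  rintro t ht ⟨r, i, s⟩
  exact key (F.n r) r i s (Nat.le_add_left _ _) t ht

/-- The left limit at `b` is included since it is the input of the next jump. -/
theorem nonneg_between_jumps {z z' zL : ℝ → F.Coord → ℝ} {a b : ℝ} (hab : a < b)
    (hr : ∀ t ∈ Set.Ico a b, HasDerivWithinAt z (z' t) (Set.Ici t) t)
    (hl : ∀ t ∈ Set.Ioc a b, Tendsto z (𝓝[<] t) (𝓝 (zL t)))
    (hj : ∀ t ∈ Set.Ioo a b, z t = zL t)
    (hge : ∀ t ∈ Set.Ico a b, ∀ l, (F.Abar *ᵥ z t) l ≤ z' t l) (h0 : ∀ l, 0 ≤ z a l) :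
    (∀ t ∈ Set.Ico a b, ∀ l, 0 ≤ z t l) ∧ ∀ l, 0 ≤ zL b l := by
  obtain ⟨hc, hd⟩ := update_left_limit hr hl hj
  have heq : ∀ t ∈ Set.Ico a b, Function.update z b (zL b) t = z t :=
    fun t ht => Function.update_of_ne ht.2.ne _ _
  have h := F.nonneg_of_deriv_ge_Abar hc hd (fun t ht l => by rw [heq t ht]; exact hge t ht l)
    (fun l => by rw [heq a ⟨le_rfl, hab⟩]; exact h0 l)
  refine ⟨fun t ht l => ?_, fun l => ?_⟩
  · simpa only [heq t ht] using h t ⟨ht.1, ht.2.le⟩ l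
  · simpa only [Function.update_self] using h b ⟨hab.le, le_rfl⟩ l

/-! ### The time-varying transformation -/

theorem d_eq_zero_or_cell_eq (r : Fin p) :
    (F.d r = 0 ∧ F.cell r = 1) ∨ F.cell r = 2 := by
  by_cases h : F.d r = 0
  · exact Or.inl ⟨h, if_pos h⟩
  · exact Or.inr (if_neg h)

theorem rot_mul_rot_neg (t : ℝ) (r : Fin p) : F.rot t r * F.rot (-t) r = 1 := by
  unfold rot
  have h := F.d_eq_zero_or_cell_eq r
  -- The cell size must be a free variable before the index type can become `Fin 1` or `Fin 2`.
  generalize F.cell r = m at h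
  rcases h with ⟨hd, rfl⟩ | rfl
  · ext i j
    fin_cases i
    fin_cases j
    simp [hd, Matrix.mul_apply]
  · ext i j
    have h1 := Real.sin_sq_add_cos_sq (F.d r * t)
    fin_cases i <;> fin_cases j <;> simp [Matrix.mul_apply] <;> linarith

/-- `rot` is the flow of `-(D - c)`, which undoes the rotation caused by the imaginary part of the
eigenvalue. -/
theorem hasDerivAt_rot (t : ℝ) (r : Fin p) (i j : Fin (F.cell r)) :
    HasDerivAt (fun t => F.rot t r i j) ((F.c r • F.rot t r - F.rot t r * F.D r) i j) t := by
  have hc : HasDerivAt (fun t => Real.cos (F.d r * t)) (-Real.sin (F.d r * t) * F.d r) t := by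
    simpa using ((hasDerivAt_id t).const_mul (F.d r)).cos
  have hs : HasDerivAt (fun t => Real.sin (F.d r * t)) (Real.cos (F.d r * t) * F.d r) t := by
    simpa using ((hasDerivAt_id t).const_mul (F.d r)).sin
  revert i j
  unfold rot D
  have h := F.d_eq_zero_or_cell_eq r
  generalize F.cell r = m at h
  rcases h with ⟨hd, rfl⟩ | rfl
  · intro i j
    fin_cases i
    fin_cases j
    simpa [hd, Matrix.mul_apply] using hasDerivAt_const t (1 : ℝ)
  · intro i j
    fin_cases i <;> fin_cases j
    · convert hc using 1 <;> simp [Matrix.mul_apply]; ring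
    · convert hs using 1 <;> simp [Matrix.mul_apply]; ring
    · refine (hs.fun_neg.congr_deriv ?_).congr_of_eventuallyEq (.of_forall fun t => ?_) <;>
        simp [Matrix.mul_apply]
      ring
    · convert hc using 1 <;> simp [Matrix.mul_apply]; ring

theorem abs_rot_le (t : ℝ) (r : Fin p) (i j : Fin (F.cell r)) : |F.rot t r i j| ≤ 1 := by
  rw [rot, Matrix.of_apply]
  split_ifs
  · exact Real.abs_cos_le_one _
  · exact Real.abs_sin_le_one _
  · rw [abs_neg]
    exact Real.abs_sin_le_one _

theorem E_mul_E_neg (t : ℝ) : F.E t * F.E (-t) = 1 := by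
  rw [E, E, ← Matrix.blockDiagonal'_mul]
  simp only [← Matrix.mul_kronecker_mul, rot_mul_rot_neg, mul_one, Matrix.one_kronecker_one]
  exact Matrix.blockDiagonal'_one

theorem E_inv (t : ℝ) : (F.E t)⁻¹ = F.E (-t) := Matrix.inv_eq_right_inv (F.E_mul_E_neg t)

theorem E_neg_mul_E (t : ℝ) : F.E (-t) * F.E t = 1 := by
  simpa using F.E_mul_E_neg (-t)

theorem hasDerivAt_E (t : ℝ) (l m : F.Coord) :
    HasDerivAt (fun t => F.E t l m) ((F.Abar * F.E t - F.E t * F.Atilde) l m) t := by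
  have h : F.Abar * F.E t - F.E t * F.Atilde = Matrix.blockDiagonal' fun r =>
      (1 : Matrix (Fin (F.n r)) (Fin (F.n r)) ℝ) ⊗ₖ (F.c r • F.rot t r - F.rot t r * F.D r) := by
    rw [Abar, E, Atilde, ← Matrix.blockDiagonal'_mul, ← Matrix.blockDiagonal'_mul,
      ← Matrix.blockDiagonal'_sub]
    congr 1
    funext r
    -- `E` commutes with the nilpotent part: both products contain `shift ⊗ rot`, which cancels in
    -- the difference.
    rw [Pi.sub_apply, Matrix.mul_add, ← Matrix.mul_kronecker_mul, ← Matrix.mul_kronecker_mul,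
      ← Matrix.mul_kronecker_mul, mul_one, one_mul, one_mul, one_mul, mul_one]
    ext ⟨i, s⟩ ⟨i', s'⟩
    simp only [Matrix.sub_apply, Matrix.add_apply, Matrix.smul_apply, Matrix.kronecker_apply,
      smul_eq_mul]
    ring
  rw [h]
  obtain ⟨r, i, s⟩ := l
  obtain ⟨r', i', s'⟩ := m
  by_cases hr : r = r'
  · subst hr
    simp only [E, Matrix.blockDiagonal'_apply_eq, Matrix.kronecker_apply]
    exact (F.hasDerivAt_rot t r s s').const_mul _
  · simp only [E, Matrix.blockDiagonal'_apply_ne _ _ _ hr]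
    exact hasDerivAt_const _ _

theorem abs_E_le (t : ℝ) (l m : F.Coord) : |F.E t l m| ≤ 1 := by
  obtain ⟨r, i, s⟩ := l
  obtain ⟨r', i', s'⟩ := m
  by_cases hr : r = r'
  · subst hr
    simp only [E, Matrix.blockDiagonal'_apply_eq, Matrix.kronecker_apply, abs_mul]
    refine mul_le_one₀ ?_ (abs_nonneg _) (F.abs_rot_le t r s s')
    rw [Matrix.one_apply]
    split_ifs <;> simp
  · simp only [E, Matrix.blockDiagonal'_apply_ne _ _ _ hr]
    simp

/-- Uniform in `t` of either sign, so the estimate serves `E(t)` and its inverse `E(-t)`. -/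
theorem norm_E_mulVec_le (t : ℝ) (v : F.Coord → ℝ) :
    ‖F.E t *ᵥ v‖ ≤ Fintype.card F.Coord * ‖v‖ := by
  refine (pi_norm_le_iff_of_nonneg (by positivity)).2 fun l => ?_
  rw [Matrix.mulVec, dotProduct]
  refine (norm_sum_le _ _).trans ?_
  calc ∑ m, ‖F.E t l m * v m‖ ≤ ∑ _m : F.Coord, ‖v‖ := by
        refine Finset.sum_le_sum fun m _ => ?_
        rw [norm_mul]
        exact (mul_le_of_le_one_left (norm_nonneg _) (F.abs_E_le t l m)).trans
          (norm_le_pi_norm v m)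
    _ = _ := by simp

end JordanShape

/-! ### Exponential decay of Hurwitz flows -/

section Flow

variable {V : Type*} [NormedAddCommGroup V] [NormedSpace ℂ V] [CompleteSpace V]

theorem hasDerivAt_flow (T : V →L[ℂ] V) (t : ℝ) :
    HasDerivAt (fun t : ℝ => NormedSpace.exp ((t : ℂ) • T))
      (NormedSpace.exp ((t : ℂ) • T) * T) t := by
  have h := (hasDerivAt_exp_smul_const T (t : ℂ)).scomp t Complex.ofRealCLM.hasDerivAt
  rw [Complex.ofRealCLM_apply, Complex.ofReal_one, one_smul] at h
  exact h

theorem hasDerivAt_flow_apply (T : V →L[ℂ] V) (v : V) (t : ℝ) :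
    HasDerivAt (fun t : ℝ => NormedSpace.exp ((t : ℂ) • T) v)
      (NormedSpace.exp ((t : ℂ) • T) (T v)) t := by
  have h := ((ContinuousLinearMap.apply ℂ V v).restrictScalars ℝ).hasFDerivAt.comp_hasDerivAt t
    (hasDerivAt_flow T t)
  exact h

/-- Growth of the flow on generalized eigenvectors. -/
theorem exists_flow_bound_of_pow_apply_eq_zero (T : V →L[ℂ] V) {μ : ℂ} {α : ℝ} (hα : μ.re < α)
    (k : ℕ) : ∀ v : V, (((T : Module.End ℂ V) - μ • 1) ^ k) v = 0 →
      ∃ C : ℝ, ∀ t : ℝ, 0 ≤ t → ‖NormedSpace.exp ((t : ℂ) • T) v‖ ≤ C * Real.exp (α * t) := by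
  induction k with
  | zero =>
    intro v hv
    refine ⟨0, fun t _ => ?_⟩
    have : v = 0 := by simpa using hv
    simp [this]
  | succ k ih =>
    intro v hv
    obtain ⟨C, hC⟩ := ih (T v - μ • v) (by
      rw [pow_succ, Module.End.mul_apply] at hv
      exact hv)
    have hC0 : 0 ≤ C := by
      have h := (norm_nonneg _).trans (hC 0 le_rfl)
      simpa using h
    set β := α - μ.re with hβ
    have hβ0 : 0 < β := by linarith
    refine ⟨‖v‖ + C / β, fun t ht => ?_⟩
    have hexp : ∀ s : ℝ, HasDerivAt (fun s : ℝ => Complex.exp (-μ * s))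
        (Complex.exp (-μ * s) * (-μ)) s := fun s => by
      have h : HasDerivAt (fun s : ℂ => Complex.exp (-μ * s)) (Complex.exp (-μ * s) * (-μ)) s := by
        simpa using ((hasDerivAt_id (s : ℂ)).const_mul (-μ)).cexp
      exact h.comp_ofReal
    have hnorm : ∀ s : ℝ, ‖Complex.exp (-μ * s)‖ = Real.exp (-μ.re * s) := fun s => by
      rw [Complex.norm_exp]
      simp
    -- After removing `e^{μs}`, the derivative involves only `T v - μ v`, killed by one power less.
    -- Its bound `C e^{βs}` integrates to `C / β * e^{βs}` at most; the gap `β > 0` absorbs the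
    -- polynomial factors.
    have hg : ∀ s : ℝ, HasDerivAt
        (fun s : ℝ => Complex.exp (-μ * s) • NormedSpace.exp ((s : ℂ) • T) v)
        (Complex.exp (-μ * s) • NormedSpace.exp ((s : ℂ) • T) (T v - μ • v)) s := fun s => by
      refine ((hexp s).smul (hasDerivAt_flow_apply T v s)).congr_deriv ?_
      rw [map_sub, map_smul, smul_sub, smul_smul, mul_neg, neg_smul]
      abel
    have hB : ∀ s : ℝ, HasDerivAt (fun s : ℝ => ‖v‖ + C / β * Real.exp (β * s))
        (C * Real.exp (β * s)) s := fun s => by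
      have h : HasDerivAt (fun s : ℝ => Real.exp (β * s)) (Real.exp (β * s) * β) s := by
        simpa using ((hasDerivAt_id s).const_mul β).exp
      refine ((h.const_mul (C / β)).const_add ‖v‖).congr_deriv ?_
      field_simp
    have key := image_norm_le_of_norm_deriv_right_le_deriv_boundary (a := 0) (b := t)
      (fun s _ => (hg s).continuousAt.continuousWithinAt)
      (fun s _ => (hg s).hasDerivWithinAt) (B := fun s : ℝ => ‖v‖ + C / β * Real.exp (β * s))
      (by
        have : 0 ≤ C / β := by positivity
        simpa using this) hB
      (fun s hs => by
        rw [norm_smul, hnorm]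
        calc Real.exp (-μ.re * s) * _ ≤ Real.exp (-μ.re * s) * (C * Real.exp (α * s)) := by
              gcongr
              exact hC s hs.1
          _ = C * Real.exp (β * s) := by
              rw [mul_left_comm, ← Real.exp_add, hβ]
              ring_nf) (Set.right_mem_Icc.2 ht)
    simp only [norm_smul, hnorm] at key
    have h1 : ‖NormedSpace.exp ((t : ℂ) • T) v‖ =
        Real.exp (μ.re * t) * (Real.exp (-μ.re * t) * ‖NormedSpace.exp ((t : ℂ) • T) v‖) := by
      rw [← mul_assoc, ← Real.exp_add]
      simp
    rw [h1]
    calc _ ≤ Real.exp (μ.re * t) * (‖v‖ + C / β * Real.exp (β * t)) := by gcongr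
      _ = ‖v‖ * Real.exp (μ.re * t) + C / β * Real.exp (α * t) := by
          have : Real.exp (α * t) = Real.exp (μ.re * t) * Real.exp (β * t) := by
            rw [← Real.exp_add, hβ]
            ring_nf
          rw [this]
          ring
      _ ≤ ‖v‖ * Real.exp (α * t) + C / β * Real.exp (α * t) := by gcongr
      _ = _ := by ring

/-- Over `ℂ` the generalized eigenspaces span, and the bound passes to sums. -/
theorem exists_flow_bound_apply [FiniteDimensional ℂ V] (T : V →L[ℂ] V) {α : ℝ}
    (hα : ∀ μ ∈ spectrum ℂ (T : Module.End ℂ V), μ.re < α) (v : V) :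
    ∃ C : ℝ, ∀ t : ℝ, 0 ≤ t → ‖NormedSpace.exp ((t : ℂ) • T) v‖ ≤ C * Real.exp (α * t) := by
  have hv : v ∈ ⨆ μ, Module.End.maxGenEigenspace (T : Module.End ℂ V) μ := by
    rw [Module.End.iSup_maxGenEigenspace_eq_top]
    exact Submodule.mem_top
  refine Submodule.iSup_induction _ (motive := fun v => ∃ C : ℝ, ∀ t : ℝ, 0 ≤ t →
    ‖NormedSpace.exp ((t : ℂ) • T) v‖ ≤ C * Real.exp (α * t)) hv (fun μ u hu => ?_)
    ⟨0, fun t _ => by simp⟩ ?_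
  · obtain ⟨k, hk⟩ := (Module.End.mem_maxGenEigenspace _ _ _).1 hu
    by_cases hμ : μ ∈ spectrum ℂ (T : Module.End ℂ V)
    · exact exists_flow_bound_of_pow_apply_eq_zero T (hα μ hμ) k u hk
    -- Off the spectrum `T - μ` is injective, so its generalized eigenspace is zero.
    · have hker : LinearMap.ker ((T : Module.End ℂ V) - μ • 1) = ⊥ := by
        by_contra h
        refine hμ (Module.End.hasEigenvalue_iff_mem_spectrum.1 ?_)
        rw [Module.End.hasEigenvalue_iff, Module.End.eigenspace_def]
        exact h
      have hinj := (LinearMap.ker_eq_bot.1 hker).iterate k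
      rw [Module.End.pow_apply] at hk
      have hu0 : u = 0 := hinj (hk.trans (by rw [← Module.End.pow_apply, map_zero]))
      exact ⟨0, fun t _ => by simp [hu0]⟩
  · rintro u u' ⟨C, hC⟩ ⟨C', hC'⟩
    refine ⟨C + C', fun t ht => ?_⟩
    rw [map_add, add_mul]
    exact (norm_add_le _ _).trans (add_le_add (hC t ht) (hC' t ht))

end Flow

theorem exists_flow_bound {n : ℕ} (T : (Fin n → ℂ) →L[ℂ] (Fin n → ℂ)) {α : ℝ}
    (hα : ∀ μ ∈ spectrum ℂ (T : Module.End ℂ (Fin n → ℂ)), μ.re < α) :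
    ∃ C : ℝ, 0 < C ∧ ∀ t : ℝ, 0 ≤ t → ∀ v,
      ‖NormedSpace.exp ((t : ℂ) • T) v‖ ≤ C * Real.exp (α * t) * ‖v‖ := by
  choose C hC using fun i : Fin n => exists_flow_bound_apply T hα (Pi.single i 1)
  -- Bounds on the basis vectors add up to one constant for all `v`; the `1` makes it positive.
  refine ⟨1 + ∑ i, |C i|, by positivity, fun t ht v => ?_⟩
  have hv : v = ∑ i, v i • (Pi.single i 1 : Fin n → ℂ) := by
    conv_lhs => rw [← Finset.univ_sum_single v]
    refine Finset.sum_congr rfl fun i _ => ?_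
    rw [← Pi.single_smul, smul_eq_mul, mul_one]
  conv_lhs => rw [hv, map_sum]
  calc ‖∑ i, NormedSpace.exp ((t : ℂ) • T) (v i • (Pi.single i 1 : Fin n → ℂ))‖
      ≤ ∑ i, |C i| * (Real.exp (α * t) * ‖v‖) := by
        refine (norm_sum_le _ _).trans (Finset.sum_le_sum fun i _ => ?_)
        rw [map_smul, norm_smul]
        calc _ ≤ ‖v‖ * (C i * Real.exp (α * t)) :=
              mul_le_mul (norm_le_pi_norm v i) (hC i t ht) (norm_nonneg _) (norm_nonneg _)
          _ ≤ ‖v‖ * (|C i| * Real.exp (α * t)) := by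
              gcongr
              exact le_abs_self _
          _ = _ := by ring
    _ = (∑ i, |C i|) * (Real.exp (α * t) * ‖v‖) := by rw [Finset.sum_mul]
    _ ≤ (1 + ∑ i, |C i|) * (Real.exp (α * t) * ‖v‖) := by
        gcongr
        linarith
    _ = _ := by ring

theorem IsHurwitz.exists_rate {n : ℕ} {M : Matrix (Fin n) (Fin n) ℝ} (hM : IsHurwitz M) :
    ∃ a : ℝ, 0 < a ∧ ∀ μ ∈ spectrum ℂ (M.map (algebraMap ℝ ℂ)), μ.re < -a := by
  have h : ∀ᶠ a : ℝ in 𝓝[>] 0, ∀ μ ∈ spectrum ℂ (M.map (algebraMap ℝ ℂ)), μ.re < -a := by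
    rw [Filter.eventually_all_finite (Matrix.finite_spectrum _)]
    intro μ hμ
    have h0 : (0 : ℝ) < -μ.re := by linarith [hM μ hμ]
    filter_upwards [mem_nhdsWithin_of_mem_nhds (Iio_mem_nhds h0)] with a ha
    rw [Set.mem_Iio] at ha
    linarith
  obtain ⟨a, ha, ha0⟩ := (h.and self_mem_nhdsWithin).exists
  exact ⟨a, ha0, ha⟩

/-- A Hurwitz system with an exponentially decaying perturbation is exponentially stable. -/
theorem IsHurwitz.exists_perturbed_bound {n : ℕ} {M : Matrix (Fin n) (Fin n) ℝ}
    (hM : IsHurwitz M) :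
    ∃ a C : ℝ, 0 < a ∧ 0 < C ∧ ∀ (δ G : ℝ), δ < a → ∀ x g : ℝ → Fin n → ℝ,
      ContinuousOn x (Set.Ici 0) →
      (∀ t, 0 ≤ t → HasDerivWithinAt x (M *ᵥ x t + g t) (Set.Ici t) t) →
      (∀ t, 0 ≤ t → ‖g t‖ ≤ G * Real.exp (-δ * t)) →
      ∀ t, 0 ≤ t → ‖x t‖ ≤ C * (‖x 0‖ + G / (a - δ)) * Real.exp (-δ * t) := by
  obtain ⟨a, ha, hspec⟩ := hM.exists_rate
  set T : (Fin n → ℂ) →L[ℂ] (Fin n → ℂ) :=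
    LinearMap.toContinuousLinearMap (Matrix.toLin' (M.map (algebraMap ℝ ℂ))) with hT
  obtain ⟨C, hC, hflow⟩ := exists_flow_bound T (α := -a) (by
    intro μ hμ
    refine hspec μ ?_
    rw [← Matrix.spectrum_toLin']
    exact hμ)
  refine ⟨a, C, ha, hC, fun δ G hδ x g hx hx' hg t ht => ?_⟩
  have hG : 0 ≤ G := by simpa using (norm_nonneg _).trans (hg 0 le_rfl)
  set ι : (Fin n → ℝ) →L[ℝ] (Fin n → ℂ) :=
    ContinuousLinearMap.pi fun i => Complex.ofRealCLM.comp (ContinuousLinearMap.proj i) with hι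
  have hιapp : ∀ v i, ι v i = (v i : ℂ) := fun v i => rfl
  have hιnorm : ∀ v, ‖ι v‖ = ‖v‖ := fun v => by
    simp only [Pi.norm_def, hιapp, Complex.nnnorm_real]
  have hιT : ∀ v, ι (M *ᵥ v) = T (ι v) := fun v => by
    ext i
    simp [hT, hιapp, Matrix.toLin'_apply, Matrix.mulVec, dotProduct]
  -- Variation of constants without integrals: `s ↦ e^{(t-s)T} x(s)` has right derivative
  -- `e^{(t-s)T} g(s)` and runs from `e^{tT} x(0)` to `x(t)`.
  set Φ : ℝ → (Fin n → ℂ) →L[ℝ] (Fin n → ℂ) := fun s =>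
    (NormedSpace.exp (((t - s : ℝ) : ℂ) • T)).restrictScalars ℝ with hΦ
  have hΦ' : ∀ s, HasDerivAt Φ (-((NormedSpace.exp (((t - s : ℝ) : ℂ) • T) * T).restrictScalars ℝ))
      s := fun s => by
    have h1 := (hasDerivAt_flow T (t - s)).scomp s ((hasDerivAt_id s).const_sub t)
    have h2 := (ContinuousLinearMap.restrictScalarsL ℂ (Fin n → ℂ) (Fin n → ℂ) ℝ
      ℝ).hasFDerivAt.comp_hasDerivAt s h1
    refine h2.congr_deriv ?_
    ext v
    simp
  have hφ : ∀ s ∈ Set.Ico 0 t, HasDerivWithinAt (fun s => Φ s (ι (x s))) (Φ s (ι (g s)))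
      (Set.Ici s) s := fun s hs => by
    have h1 := (hΦ' s).hasDerivWithinAt (s := Set.Ici s)
    have h2 := ι.hasFDerivAt.comp_hasDerivWithinAt s (hx' s hs.1)
    refine (h1.clm_apply h2).congr_deriv ?_
    rw [map_add, hιT, map_add]
    simp [hΦ]
  have hcont : ContinuousOn (fun s => Φ s (ι (x s))) (Set.Icc 0 t) := by
    refine ContinuousOn.clm_apply (fun s _ => (hΦ' s).continuousAt.continuousWithinAt) ?_
    exact ι.continuous.comp_continuousOn (hx.mono Set.Icc_subset_Ici_self)
  have hbound : ∀ s ∈ Set.Icc 0 t, ∀ v, ‖Φ s (ι v)‖ ≤ C * Real.exp (-a * (t - s)) * ‖v‖ :=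
    fun s hs v => by
      rw [← hιnorm v]
      exact hflow (t - s) (by linarith [hs.2]) (ι v)
  set β := a - δ with hβ
  have hβ0 : 0 < β := by linarith
  -- The comparison function is a primitive of the bound on that derivative; `δ < a` keeps `β`
  -- positive.
  have hB : ∀ s : ℝ, HasDerivAt
      (fun s : ℝ => C * Real.exp (-a * t) * ‖x 0‖ +
        C * G / β * Real.exp (-a * t) * Real.exp (β * s))
      (C * G * Real.exp (-a * t) * Real.exp (β * s)) s := fun s => by
    have h : HasDerivAt (fun s : ℝ => Real.exp (β * s)) (Real.exp (β * s) * β) s := by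
      simpa using ((hasDerivAt_id s).const_mul β).exp
    refine ((h.const_mul (C * G / β * Real.exp (-a * t))).const_add _).congr_deriv ?_
    field_simp
  have key := image_norm_le_of_norm_deriv_right_le_deriv_boundary hcont hφ
    (B := fun s : ℝ => C * Real.exp (-a * t) * ‖x 0‖ +
        C * G / β * Real.exp (-a * t) * Real.exp (β * s)) (by
      have h1 := hbound 0 ⟨le_rfl, ht⟩ (x 0)
      rw [sub_zero] at h1
      refine h1.trans (le_add_of_nonneg_right (by positivity))) hB
    (fun s hs => by
      refine (hbound s ⟨hs.1, hs.2.le⟩ (g s)).trans ?_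
      calc _ ≤ C * Real.exp (-a * (t - s)) * (G * Real.exp (-δ * s)) := by
            gcongr
            exact hg s hs.1
        _ = C * G * (Real.exp (-a * (t - s)) * Real.exp (-δ * s)) := by ring
        _ = C * G * (Real.exp (-a * t) * Real.exp (β * s)) := by
            rw [← Real.exp_add, ← Real.exp_add, hβ]
            ring_nf
        _ = _ := by ring) (Set.right_mem_Icc.2 ht)
  have hend : ‖Φ t (ι (x t))‖ = ‖x t‖ := by
    rw [← hιnorm]
    simp only [hΦ, ContinuousLinearMap.coe_restrictScalars']
    have h0 : ((t - t : ℝ) : ℂ) • T = 0 := by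
      rw [sub_self, Complex.ofReal_zero]
      exact zero_smul ℂ T
    rw [h0, NormedSpace.exp_zero]
    rfl
  simp only [hend] at key
  refine key.trans ?_
  have e1 : Real.exp (-a * t) * Real.exp (β * t) = Real.exp (-δ * t) := by
    rw [← Real.exp_add, hβ]
    ring_nf
  have e2 : Real.exp (-a * t) ≤ Real.exp (-δ * t) := by
    gcongr
  calc _ = C * ‖x 0‖ * Real.exp (-a * t) +
        C * G / β * (Real.exp (-a * t) * Real.exp (β * t)) := by ring
    _ ≤ C * ‖x 0‖ * Real.exp (-δ * t) + C * G / β * Real.exp (-δ * t) := by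
        rw [e1]
        gcongr
    _ = _ := by ring

/-! ### The closed loop -/

theorem norm_le_enorm2 {ι : Type} [Fintype ι] (v : ι → ℝ) : ‖v‖ ≤ enorm2 v :=
  (pi_norm_le_iff_of_nonneg (norm_nonneg _)).2 fun i => PiLp.norm_apply_le (WithLp.toLp 2 v) i

theorem enorm2_le {ι : Type} [Fintype ι] (v : ι → ℝ) : enorm2 v ≤ Fintype.card ι * ‖v‖ := by
  have h : enorm2 v ^ 2 ≤ (Fintype.card ι * ‖v‖) ^ 2 := by
    rw [enorm2, EuclideanSpace.norm_sq_eq]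
    calc ∑ i, ‖v i‖ ^ 2 ≤ ∑ _i : ι, ‖v‖ ^ 2 := by
          refine Finset.sum_le_sum fun i _ => ?_
          gcongr
          exact norm_le_pi_norm v i
      _ = Fintype.card ι * ‖v‖ ^ 2 := by simp
      _ ≤ (Fintype.card ι : ℝ) ^ 2 * ‖v‖ ^ 2 := by
          gcongr
          exact_mod_cast Nat.le_self_pow two_ne_zero _
      _ = _ := by ring
  exact le_of_sq_le_sq h (by positivity)

theorem exists_norm_mulVec_le {m n : Type*} [Fintype m] [Fintype n] [DecidableEq n]
    (M : Matrix m n ℝ) : ∃ C : ℝ, 0 ≤ C ∧ ∀ v, ‖M *ᵥ v‖ ≤ C * ‖v‖ :=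
  ⟨‖LinearMap.toContinuousLinearMap (Matrix.toLin' M)‖, norm_nonneg _, fun v =>
    (LinearMap.toContinuousLinearMap (Matrix.toLin' M)).le_opNorm v⟩

theorem hasDerivWithinAt_mulVec {m n : Type*} [Fintype m] [Fintype n] [DecidableEq n]
    (M : Matrix m n ℝ) {f : ℝ → n → ℝ} {f' : n → ℝ} {s : Set ℝ} {t : ℝ}
    (hf : HasDerivWithinAt f f' s t) :
    HasDerivWithinAt (fun t => M *ᵥ f t) (M *ᵥ f') s t :=
  (LinearMap.toContinuousLinearMap (Matrix.toLin' M)).hasFDerivAt.comp_hasDerivWithinAt t hf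

theorem JordanShape.mul_eq_Atilde_mul {nx p : ℕ} {A : Matrix (Fin nx) (Fin nx) ℝ}
    {F : JordanShape p} {S : Matrix F.Coord (Fin nx) ℝ} {Sinv : Matrix (Fin nx) F.Coord ℝ}
    (hS' : Sinv * S = 1) (hA : S * A * Sinv = F.Atilde) : S * A = F.Atilde * S := by
  rw [← hA, Matrix.mul_assoc, hS', Matrix.mul_one]

/-- In the product rule the term `-E Ã S x` from `E'` cancels `E S A x`, because `S A = Ã S`. -/
theorem hasDerivWithinAt_xbar {nx p : ℕ} {A : Matrix (Fin nx) (Fin nx) ℝ}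
    {F : JordanShape p} {S : Matrix F.Coord (Fin nx) ℝ} {Sinv : Matrix (Fin nx) F.Coord ℝ}
    (hS' : Sinv * S = 1) (hA : S * A * Sinv = F.Atilde) {x : ℝ → Fin nx → ℝ} {b : Fin nx → ℝ}
    {s : Set ℝ} {t : ℝ} (hx : HasDerivWithinAt x (A *ᵥ x t + b) s t) :
    HasDerivWithinAt (xbar F S x) (F.Abar *ᵥ xbar F S x t + (F.E t * S) *ᵥ b) s t := by
  rw [hasDerivWithinAt_pi]
  intro l
  have hy := hasDerivWithinAt_pi.1 (hasDerivWithinAt_mulVec S hx)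
  have h : HasDerivWithinAt (fun t => ∑ m, F.E t l m * (S *ᵥ x t) m)
      (∑ m, ((F.Abar * F.E t - F.E t * F.Atilde) l m * (S *ᵥ x t) m +
        F.E t l m * (S *ᵥ (A *ᵥ x t + b)) m)) s t :=
    HasDerivWithinAt.fun_sum fun m _ => (F.hasDerivAt_E t l m).hasDerivWithinAt.mul (hy m)
  have hfun : (fun t => xbar F S x t l) = fun t => ∑ m, F.E t l m * (S *ᵥ x t) m := by
    funext t
    rw [xbar, ← Matrix.mulVec_mulVec]
    rfl
  rw [hfun]
  refine h.congr_deriv ?_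
  rw [Finset.sum_add_distrib]
  change ((F.Abar * F.E t - F.E t * F.Atilde) *ᵥ (S *ᵥ x t) +
    F.E t *ᵥ (S *ᵥ (A *ᵥ x t + b))) l = _
  refine congrFun ?_ l
  rw [Matrix.mulVec_add, Matrix.mulVec_mulVec (x t) S A, JordanShape.mul_eq_Atilde_mul hS' hA,
    Matrix.sub_mulVec, Matrix.mulVec_add, xbar]
  simp only [← Matrix.mulVec_mulVec]
  abel

theorem continuousOn_xbar {nx p : ℕ} {F : JordanShape p} (S : Matrix F.Coord (Fin nx) ℝ)
    {x : ℝ → Fin nx → ℝ} {s : Set ℝ} (hx : ContinuousOn x s) : ContinuousOn (xbar F S x) s := by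
  refine continuousOn_pi.2 fun l => ?_
  have h : ContinuousOn (fun t => ∑ m, F.E t l m * (S *ᵥ x t) m) s := by
    refine continuousOn_finsetSum _ fun m _ => ContinuousOn.mul
      (fun t _ => (F.hasDerivAt_E t l m).continuousAt.continuousWithinAt) ?_
    exact (continuous_apply m).comp_continuousOn
      ((Continuous.matrix_mulVec continuous_const continuous_id).comp_continuousOn hx)
  refine h.congr fun t _ => ?_
  rw [xbar, ← Matrix.mulVec_mulVec]
  rfl

namespace IsClosedLoop

variable {nx nu p : ℕ} {A : Matrix (Fin nx) (Fin nx) ℝ} {B : Matrix (Fin nx) (Fin nu) ℝ}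
  {K : Matrix (Fin nu) (Fin nx) ℝ} {F : JordanShape p} {S : Matrix F.Coord (Fin nx) ℝ}
  {Sinv : Matrix (Fin nx) F.Coord ℝ} {dos : DoS} {Δ : ℝ} {bits : Fin p → ℕ → ℕ}
  {x : ℝ → Fin nx → ℝ} {xhat xhatL J JL : ℝ → F.Coord → ℝ}

/-- Both equations contain the same input term `E S B u`, which drops out. -/
theorem hasDerivWithinAt_error (h : IsClosedLoop A B K F S Sinv dos Δ bits x xhat xhatL J JL)
    (hS' : Sinv * S = 1) (hA : S * A * Sinv = F.Atilde) {t : ℝ} (ht : 0 ≤ t) :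
    HasDerivWithinAt (fun t => xhat t - xbar F S x t)
      (F.Abar *ᵥ (xhat t - xbar F S x t)) (Set.Ici t) t := by
  refine ((h.xhat_flow t ht).sub (hasDerivWithinAt_xbar hS' hA (h.x_flow t ht))).congr_deriv ?_
  rw [Matrix.mulVec_mulVec, Matrix.mulVec_sub]
  abel

theorem tendsto_error_left (h : IsClosedLoop A B K F S Sinv dos Δ bits x xhat xhatL J JL)
    {t : ℝ} (ht : 0 < t) :
    Tendsto (fun t => xhat t - xbar F S x t) (𝓝[<] t) (𝓝 (xhatL t - xbar F S x t)) := by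
  refine (h.xhat_left t ht).sub ?_
  have hc := (continuousOn_xbar S h.x_cont).continuousAt (Ici_mem_nhds ht)
  exact hc.tendsto.mono_left nhdsWithin_le_nhds

/-- At a transmission attempt the quantization range stays an error bound and shrinks according
to the number of received bits. -/
theorem jump (h : IsClosedLoop A B K F S Sinv dos Δ bits x xhat xhatL J JL) (hΔ : 0 < Δ) (k : ℕ)
    {l : F.Coord}
    (hl : |xhatL (k * Δ) l - xbar F S x (k * Δ) l| ≤ JL (k * Δ) l) :
    |xhat (k * Δ) l - xbar F S x (k * Δ) l| ≤ J (k * Δ) l ∧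
      J (k * Δ) l = ((2 : ℝ) ^ (open Classical in if dos.Success Δ k then bits l.1 k else 0))⁻¹ *
        JL (k * Δ) l := by
  classical
  by_cases hk : dos.Success Δ k
  · rw [if_pos hk]
    refine ⟨?_, h.J_jump k hk l⟩
    rw [h.J_jump k hk l, h.xhat_jump k hk l, sub_right_comm]
    exact abs_sub_mul_quantizer_le _ hl
  -- Different attempts have different instants, so no success can occur at `kΔ` when attempt `k`
  -- fails.
  · obtain ⟨h1, h2⟩ := h.no_jump (k * Δ) (by positivity) (fun j hj hkj => by
      have : (k : ℝ) = j := mul_right_cancel₀ hΔ.ne' hkj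
      rw [Nat.cast_inj] at this
      exact hk (this ▸ hj))
    rw [h1, h2, if_neg hk]
    exact ⟨hl, by simp⟩

/-- Between two attempts the error obeys the quantization range, and the range obeys any bound of
the form `M_r ε^i e^{(c_r + ε) t}`. -/
theorem flow (h : IsClosedLoop A B K F S Sinv dos Δ bits x xhat xhatL J JL) (hΔ : 0 < Δ)
    (hS' : Sinv * S = 1) (hA : S * A * Sinv = F.Atilde) {ε : ℝ} (hε : 0 < ε) {M : Fin p → ℝ}
    (hM : ∀ r, 0 ≤ M r) (k : ℕ)
    (he : ∀ l, |xhat (k * Δ) l - xbar F S x (k * Δ) l| ≤ J (k * Δ) l)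
    (hJ : ∀ l : F.Coord, J (k * Δ) l ≤
      M l.1 * ε ^ (l.2.1 : ℕ) * Real.exp ((F.c l.1 + ε) * (k * Δ))) :
    (∀ t ∈ Set.Ico (k * Δ) ((k + 1 : ℕ) * Δ), ∀ l : F.Coord,
      |xhat t l - xbar F S x t l| ≤ J t l ∧
      J t l ≤ M l.1 * ε ^ (l.2.1 : ℕ) * Real.exp ((F.c l.1 + ε) * t)) ∧
    ∀ l : F.Coord, |xhatL ((k + 1 : ℕ) * Δ) l - xbar F S x ((k + 1 : ℕ) * Δ) l| ≤
        JL ((k + 1 : ℕ) * Δ) l ∧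
      JL ((k + 1 : ℕ) * Δ) l ≤
        M l.1 * ε ^ (l.2.1 : ℕ) * Real.exp ((F.c l.1 + ε) * ((k + 1 : ℕ) * Δ)) := by
  set a : ℝ := k * Δ
  set b : ℝ := (k + 1 : ℕ) * Δ
  have hab : a < b := by
    simp only [a, b]
    gcongr
    exact Nat.lt_succ_self k
  have ha : 0 ≤ a := by positivity
  have hno : ∀ t ∈ Set.Ioo a b, xhat t = xhatL t ∧ J t = JL t := fun t ht => by
    refine h.no_jump t (ha.trans ht.1.le) fun j _ hj => ?_
    have h1 : k < j := by
      have := ht.1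
      rw [hj] at this
      exact_mod_cast lt_of_mul_lt_mul_right this hΔ.le
    have h2 : j < k + 1 := by
      have := ht.2
      rw [hj] at this
      exact_mod_cast lt_of_mul_lt_mul_right this hΔ.le
    omega
  have hed : ∀ t ∈ Set.Ico a b, _ := fun t ht => h.hasDerivWithinAt_error hS' hA (ha.trans ht.1)
  have hJd : ∀ t ∈ Set.Ico a b, _ := fun t ht => h.J_flow t (ha.trans ht.1)
  have hel : ∀ t ∈ Set.Ioc a b, _ := fun t ht => h.tendsto_error_left (ha.trans_lt ht.1)
  have hJl : ∀ t ∈ Set.Ioc a b, _ := fun t ht => h.J_left t (ha.trans_lt ht.1)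
  -- `J - e` and `J + e` both solve `z' = Ā z` and start nonnegative.
  have hsub := F.nonneg_between_jumps hab (fun t ht => (hJd t ht).fun_sub (hed t ht))
    (fun t ht => (hJl t ht).sub (hel t ht))
    (fun t ht => by rw [(hno t ht).1, (hno t ht).2])
    (fun t _ l => by rw [Matrix.mulVec_sub])
    (fun l => sub_nonneg.2 ((le_abs_self _).trans (he l)))
  have hadd := F.nonneg_between_jumps hab (fun t ht => (hJd t ht).fun_add (hed t ht))
    (fun t ht => (hJl t ht).add (hel t ht))
    (fun t ht => by rw [(hno t ht).1, (hno t ht).2])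
    (fun t _ l => by rw [Matrix.mulVec_add])
    (fun l => by
      have := (neg_le_abs _).trans (he l)
      simp only [Pi.add_apply, Pi.sub_apply]
      linarith)
  set U : ℝ → F.Coord → ℝ := fun t l =>
    M l.1 * ε ^ (l.2.1 : ℕ) * Real.exp ((F.c l.1 + ε) * t) with hU
  have hUd : ∀ t, HasDerivAt U (fun l => (F.c l.1 + ε) * U t l) t := fun t => by
    refine hasDerivAt_pi.2 fun l => ?_
    have h1 : HasDerivAt (fun t => Real.exp ((F.c l.1 + ε) * t))
        (Real.exp ((F.c l.1 + ε) * t) * (F.c l.1 + ε)) t := by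
      simpa using ((hasDerivAt_id t).const_mul (F.c l.1 + ε)).exp
    refine (h1.const_mul (M l.1 * ε ^ (l.2.1 : ℕ))).congr_deriv ?_
    simp only [hU]
    ring
  -- The neighbour in the chain has weight `ε ^ (i + 1)`, so it contributes exactly `ε * U`; at the
  -- end of the chain there is none. Thus `U` is a supersolution.
  have hUA : ∀ t l, (F.Abar *ᵥ U t) l ≤ (F.c l.1 + ε) * U t l := by
    rintro t ⟨r, i, s⟩
    rw [F.Abar_mulVec_apply, add_mul]
    refine add_le_add le_rfl ?_
    have hMr := hM r
    split_ifs
    · simp only [hU, pow_succ]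
      exact le_of_eq (by ring)
    · simp only [hU]
      positivity
  have hUJ := F.nonneg_between_jumps hab
    (fun t ht => (hUd t).hasDerivWithinAt.fun_sub (hJd t ht))
    (fun t ht => ((hUd t).continuousAt.tendsto.mono_left nhdsWithin_le_nhds).sub (hJl t ht))
    (fun t ht => by rw [(hno t ht).2])
    (fun t _ l => by
      rw [Matrix.mulVec_sub, Pi.sub_apply, Pi.sub_apply]
      exact sub_le_sub_right (hUA t l) _)
    (fun l => sub_nonneg.2 (hJ l))
  simp only [Pi.sub_apply, Pi.add_apply] at hsub hadd hUJ
  refine ⟨fun t ht l => ⟨abs_le.2 ⟨?_, ?_⟩, ?_⟩, fun l => ⟨abs_le.2 ⟨?_, ?_⟩, ?_⟩⟩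
  · linarith [hadd.1 t ht l]
  · linarith [hsub.1 t ht l]
  · linarith [hUJ.1 t ht l]
  · linarith [hadd.2 l]
  · linarith [hsub.2 l]
  · linarith [hUJ.2 l]

/-- Induction over attempts with `2^{-totalBits}` absorbed into `M r`; this is possible because all
coordinates of a block receive equally many bits. -/
theorem error_le_range_le (h : IsClosedLoop A B K F S Sinv dos Δ bits x xhat xhatL J JL)
    (hΔ : 0 < Δ) (hS' : Sinv * S = 1) (hA : S * A * Sinv = F.Atilde) {ε : ℝ} (hε : 0 < ε)
    {M : Fin p → ℝ} (hM : ∀ r, 0 ≤ M r)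
    (h0 : ∀ l : F.Coord, JL 0 l ≤ M l.1 * ε ^ (l.2.1 : ℕ)) (k : ℕ) {t : ℝ}
    (ht : t ∈ Set.Ico (k * Δ) ((k + 1 : ℕ) * Δ)) (l : F.Coord) :
    |xhat t l - xbar F S x t l| ≤ J t l ∧
      J t l ≤ M l.1 * ε ^ (l.2.1 : ℕ) *
        (Real.exp ((F.c l.1 + ε) * t) * ((2 : ℝ) ^ totalBits dos Δ (bits l.1) k)⁻¹) := by
  classical
  have hM' : ∀ k r, 0 ≤ M r * ((2 : ℝ) ^ totalBits dos Δ (bits r) k)⁻¹ := fun k r =>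
    mul_nonneg (hM r) (by positivity)
  have key : ∀ k : ℕ, ∀ l : F.Coord,
      |xhat (k * Δ) l - xbar F S x (k * Δ) l| ≤ J (k * Δ) l ∧
      J (k * Δ) l ≤ M l.1 * ((2 : ℝ) ^ totalBits dos Δ (bits l.1) k)⁻¹ * ε ^ (l.2.1 : ℕ) *
        Real.exp ((F.c l.1 + ε) * (k * Δ)) := by
    intro k
    induction k with
    | zero =>
      intro l
      have h1 := h.jump hΔ 0 (l := l) (by
        simpa [h.xhat_init] using (h.J_init l).le)
      refine ⟨h1.1, ?_⟩
      rw [h1.2, totalBits, Finset.sum_range_one]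
      simp only [Nat.cast_zero, zero_mul, mul_zero, Real.exp_zero, mul_one]
      calc _ ≤ _ := mul_le_mul_of_nonneg_left (h0 l) (by positivity)
        _ = _ := by ring
    | succ k ih =>
      intro l
      have h2 := (h.flow hΔ hS' hA hε (hM' k) k (fun l => (ih l).1) fun l => (ih l).2).2 l
      have h1 := h.jump hΔ (k + 1) h2.1
      refine ⟨h1.1, ?_⟩
      rw [h1.2, totalBits, Finset.sum_range_succ, pow_add, mul_inv]
      calc _ ≤ _ := mul_le_mul_of_nonneg_left h2.2 (by positivity)
        _ = _ := by
          rw [totalBits]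
          ring
  have h3 := (h.flow hΔ hS' hA hε (hM' k) k (fun l => (key k l).1) fun l => (key k l).2).1 t ht l
  refine ⟨h3.1, h3.2.trans_eq ?_⟩
  ring

/-- Since `x = S⁻¹ E⁻¹ x̄`, the input is `K x` plus a term linear in the error. -/
theorem hasDerivWithinAt_state (h : IsClosedLoop A B K F S Sinv dos Δ bits x xhat xhatL J JL)
    (hS' : Sinv * S = 1) {t : ℝ} (ht : 0 ≤ t) :
    HasDerivWithinAt x ((A + B * K) *ᵥ x t +
      (B * K * Sinv) *ᵥ (F.E (-t) *ᵥ (xhat t - xbar F S x t))) (Set.Ici t) t := by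
  refine (h.x_flow t ht).congr_deriv ?_
  have hx : Sinv *ᵥ (F.E (-t) *ᵥ xbar F S x t) = x t := by
    rw [xbar, Matrix.mulVec_mulVec, Matrix.mulVec_mulVec, Matrix.mul_assoc,
      ← Matrix.mul_assoc (F.E (-t)), F.E_neg_mul_E, Matrix.one_mul, hS', Matrix.one_mulVec]
  rw [controlInput, F.E_inv, Matrix.mulVec_sub, Matrix.mulVec_sub, Matrix.add_mulVec]
  simp only [← Matrix.mulVec_mulVec, hx]
  abel

end IsClosedLoop

end QuantizedDoS

/-! ### Choice of the rate and the constants -/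

theorem theorem3 {nx nu p : ℕ}
    (A : Matrix (Fin nx) (Fin nx) ℝ) (B : Matrix (Fin nx) (Fin nu) ℝ)
    (K : Matrix (Fin nu) (Fin nx) ℝ) (hK : QuantizedDoS.IsHurwitz (A + B * K))
    (F : QuantizedDoS.JordanShape p)
    (S : Matrix F.Coord (Fin nx) ℝ) (Sinv : Matrix (Fin nx) F.Coord ℝ)
    (hS : S * Sinv = 1) (hS' : Sinv * S = 1) (hA : S * A * Sinv = F.Atilde)
    (Δ : ℝ) (hΔ : 0 < Δ)
    (η τD κ T : ℝ) (hη : 0 ≤ η) (hτD : 0 < τD) (hκ : 0 ≤ κ) (hT : 1 < T)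
    (hDoS : 1 / T + Δ / τD < 1)
    (R : Fin p → ℕ)
    (hR : ∀ r, 0 ≤ F.c r →
      1 / (1 - 1 / T - Δ / τD) * F.c r * Δ * Real.logb 2 (Real.exp 1) < (R r : ℝ))
    (w : Fin p → ℝ) (hw : ∀ r, F.c r < w r) :
    ∃ C δ : ℝ, 0 < C ∧ 0 < δ ∧
      ∀ dos : QuantizedDoS.DoS, dos.FrequencyBound η τD → dos.DurationBound κ T →
      ∀ bits : Fin p → ℕ → ℕ, QuantizedDoS.FollowsBitProtocol dos Δ F.c w R bits →
      ∀ (x : ℝ → Fin nx → ℝ) (xhat xhatL J JL : ℝ → F.Coord → ℝ),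
        QuantizedDoS.IsClosedLoop A B K F S Sinv dos Δ bits x xhat xhatL J JL →
        ∀ t : ℝ, 0 ≤ t →
          QuantizedDoS.enorm2 (x t) ≤
            C * Real.exp (-δ * t) * (QuantizedDoS.enorm2 (x 0) + QuantizedDoS.enorm2 (JL 0)) ∧
          QuantizedDoS.enorm2 (xhat t) ≤
            C * Real.exp (-δ * t) * (QuantizedDoS.enorm2 (x 0) + QuantizedDoS.enorm2 (JL 0)) ∧
          QuantizedDoS.enorm2 (J t) ≤
            C * Real.exp (-δ * t) * (QuantizedDoS.enorm2 (x 0) + QuantizedDoS.enorm2 (JL 0)) := by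
  obtain ⟨a, Cx, ha, hCx, hstab⟩ := hK.exists_perturbed_bound
  choose Cr μ hCr hμ hgrow using fun r => QuantizedDoS.exists_discounted_growth_bound (η := η)
    hΔ hκ (zero_lt_one.trans hT) (by linarith : 0 < 1 - 1 / T - Δ / τD) (hR r) (hw r)
  -- `δ` is also the `ε` of the weights. It costs a factor `e^{δt}`, so `δ < μ r / 2` still leaves
  -- `e^{-δt}`; `δ < a` serves the Hurwitz estimate and `δ < 1` the comparison of powers.
  obtain ⟨δ, hδ0, hδa, hδ1, hδμ⟩ : ∃ δ : ℝ, 0 < δ ∧ δ < a ∧ δ < 1 ∧ ∀ r, δ < μ r / 2 := by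
    have h1 : ∀ b : ℝ, 0 < b → ∀ᶠ δ : ℝ in 𝓝[>] 0, δ < b := fun b hb =>
      mem_nhdsWithin_of_mem_nhds (Iio_mem_nhds hb)
    obtain ⟨δ, h⟩ := (((h1 a ha).and ((h1 1 one_pos).and (Filter.eventually_all.2 fun r =>
      h1 (μ r / 2) (half_pos (hμ r))))).and self_mem_nhdsWithin).exists
    exact ⟨δ, h.2, h.1.1, h.1.2.1, h.1.2.2⟩
  obtain ⟨c₁, hc₁, hc₁'⟩ := QuantizedDoS.exists_norm_mulVec_le (B * K * Sinv)
  obtain ⟨c₂, hc₂, hc₂'⟩ := QuantizedDoS.exists_norm_mulVec_le S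
  set N : ℝ := ((Fintype.card F.Coord : ℕ) : ℝ)
  have hN : 0 ≤ N := Nat.cast_nonneg _
  -- The divisor `δ ^ n_r` comes from `M r = ‖JL 0‖ / δ ^ n_r`, which dominates the initial range
  -- despite the weights `δ ^ i`, `i < n_r`.
  set D : ℝ := ∑ r, Cr r / δ ^ F.n r with hD
  have hDterm : ∀ r, 0 ≤ Cr r / δ ^ F.n r := fun r => div_nonneg (hCr r).le (by positivity)
  have hD0 : 0 ≤ D := Finset.sum_nonneg fun r _ => hDterm r
  set Q : ℝ := Cx * (1 + c₁ * (N * D) / (a - δ)) with hQ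
  have haδ : 0 < a - δ := by linarith
  have hQ0 : 0 ≤ Q := by positivity
  -- The first factor covers the passage from sup norm to Euclidean norm in both dimensions; the
  -- second dominates the constants of `x`, `x̂` and `J`.
  refine ⟨(nx + N + 1) * (Q + N * c₂ * Q + D + 1), δ, by positivity, hδ0, ?_⟩
  intro dos hf hd bits hbits x xhat xhatL J JL h t ht
  set X : ℝ := ‖x 0‖ + ‖JL 0‖ with hX
  have hX0 : 0 ≤ X := by positivity
  have hJe : ∀ t, 0 ≤ t → ‖xhat t - QuantizedDoS.xbar F S x t‖ ≤ D * ‖JL 0‖ * Real.exp (-δ * t) ∧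
      ‖J t‖ ≤ D * ‖JL 0‖ * Real.exp (-δ * t) := by
    intro t ht
    have hk : t ∈ Set.Ico ((⌊t / Δ⌋₊ : ℝ) * Δ) ((⌊t / Δ⌋₊ + 1 : ℕ) * Δ) := by
      refine ⟨(le_div_iff₀ hΔ).1 (Nat.floor_le (by positivity)), (div_lt_iff₀ hΔ).1 ?_⟩
      rw [Nat.cast_add_one]
      exact Nat.lt_floor_add_one _
    have hl : ∀ l, |xhat t l - QuantizedDoS.xbar F S x t l| ≤ J t l ∧
        J t l ≤ D * ‖JL 0‖ * Real.exp (-δ * t) := by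
      intro l
      have h1 := h.error_le_range_le hΔ hS' hA hδ0 (M := fun r => ‖JL 0‖ / δ ^ F.n r)
        (fun r => by positivity) (fun l => by
          have h2 : δ ^ F.n l.1 ≤ δ ^ (l.2.1 : ℕ) :=
            pow_le_pow_of_le_one hδ0.le hδ1.le l.2.1.2.le
          rw [div_mul_eq_mul_div, le_div_iff₀ (by positivity)]
          exact mul_le_mul ((le_abs_self _).trans (norm_le_pi_norm (JL 0) l)) h2
            (by positivity) (norm_nonneg _)) _ hk l
      refine ⟨h1.1, h1.2.trans ?_⟩
      have h2 := hgrow l.1 dos hf hd (bits l.1) (hbits l.1) _ t hk.1 (by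
        have := hk.2.le
        rwa [Nat.cast_add_one] at this)
      have h3 : Real.exp ((F.c l.1 + δ) * t) *
          ((2 : ℝ) ^ QuantizedDoS.totalBits dos Δ (bits l.1) ⌊t / Δ⌋₊)⁻¹ ≤
          Cr l.1 * Real.exp (-δ * t) := by
        calc _ = Real.exp (δ * t) * (Real.exp (F.c l.1 * t) *
              ((2 : ℝ) ^ QuantizedDoS.totalBits dos Δ (bits l.1) ⌊t / Δ⌋₊)⁻¹) := by
              rw [add_mul, Real.exp_add]
              ring
          _ ≤ Real.exp (δ * t) * (Cr l.1 * Real.exp (-μ l.1 * t)) := by gcongr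
          _ = Cr l.1 * Real.exp (δ * t + -μ l.1 * t) := by
              rw [Real.exp_add]
              ring
          _ ≤ Cr l.1 * Real.exp (-δ * t) := by
              refine mul_le_mul_of_nonneg_left (Real.exp_le_exp.2 ?_) (hCr _).le
              rw [← add_mul]
              gcongr
              linarith [hδμ l.1]
      calc _ ≤ ‖JL 0‖ / δ ^ F.n l.1 * 1 * (Cr l.1 * Real.exp (-δ * t)) := by
            gcongr
            exact pow_le_one₀ hδ0.le hδ1.le
        _ = Cr l.1 / δ ^ F.n l.1 * (‖JL 0‖ * Real.exp (-δ * t)) := by ring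
        _ ≤ D * (‖JL 0‖ * Real.exp (-δ * t)) := by
            gcongr
            exact Finset.single_le_sum (f := fun r => Cr r / δ ^ F.n r)
              (fun r _ => hDterm r) (Finset.mem_univ l.1)
        _ = _ := by ring
    constructor
    · exact (pi_norm_le_iff_of_nonneg (by positivity)).2 fun l => (hl l).1.trans (hl l).2
    · refine (pi_norm_le_iff_of_nonneg (by positivity)).2 fun l => ?_
      rw [Real.norm_eq_abs, abs_of_nonneg ((abs_nonneg _).trans (hl l).1)]
      exact (hl l).2
  have hx : ‖x t‖ ≤ Q * X * Real.exp (-δ * t) := by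
    have h1 := hstab δ (c₁ * (N * (D * ‖JL 0‖))) hδa x _ h.x_cont
      (fun t ht => h.hasDerivWithinAt_state hS' ht) (fun t ht => by
        calc _ ≤ c₁ * ‖F.E (-t) *ᵥ (xhat t - QuantizedDoS.xbar F S x t)‖ := hc₁' _
          _ ≤ c₁ * (N * (D * ‖JL 0‖ * Real.exp (-δ * t))) := by
              gcongr
              refine (F.norm_E_mulVec_le _ _).trans ?_
              gcongr
              exact (hJe t ht).1
          _ = _ := by ring) t ht
    refine h1.trans (mul_le_mul_of_nonneg_right ?_ (Real.exp_pos _).le)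
    -- The missing cross terms are added so that the bound factors as `Q * X`.
    have h3 : 0 ≤ Cx * (‖JL 0‖ + c₁ * (N * D) / (a - δ) * ‖x 0‖) := by positivity
    calc Cx * (‖x 0‖ + c₁ * (N * (D * ‖JL 0‖)) / (a - δ))
        ≤ Cx * (‖x 0‖ + c₁ * (N * (D * ‖JL 0‖)) / (a - δ)) +
          Cx * (‖JL 0‖ + c₁ * (N * D) / (a - δ) * ‖x 0‖) := le_add_of_nonneg_right h3
      _ = Q * X := by
          rw [hQ, hX]
          ring
  have hJX : D * ‖JL 0‖ ≤ D * X := by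
    gcongr
    exact le_add_of_nonneg_left (norm_nonneg _)
  have hJ' : ‖J t‖ ≤ D * X * Real.exp (-δ * t) := (hJe t ht).2.trans (by gcongr)
  have hxhat : ‖xhat t‖ ≤ (N * c₂ * Q + D) * X * Real.exp (-δ * t) := by
    calc ‖xhat t‖ = ‖QuantizedDoS.xbar F S x t + (xhat t - QuantizedDoS.xbar F S x t)‖ := by
          rw [add_sub_cancel]
      _ ≤ N * (c₂ * (Q * X * Real.exp (-δ * t))) + D * X * Real.exp (-δ * t) := by
          refine (norm_add_le _ _).trans (add_le_add ?_ ((hJe t ht).1.trans (by gcongr)))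
          rw [QuantizedDoS.xbar, ← Matrix.mulVec_mulVec]
          refine (F.norm_E_mulVec_le _ _).trans ?_
          gcongr
          exact (hc₂' _).trans (by gcongr)
      _ = _ := by ring
  have hXY : X ≤ QuantizedDoS.enorm2 (x 0) + QuantizedDoS.enorm2 (JL 0) :=
    add_le_add (QuantizedDoS.norm_le_enorm2 _) (QuantizedDoS.norm_le_enorm2 _)
  have hfin : ∀ n q : ℝ, 0 ≤ n → n ≤ nx + N + 1 → q ≤ Q + N * c₂ * Q + D + 1 →
      ∀ v : ℝ, v ≤ q * X * Real.exp (-δ * t) →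
      n * v ≤ (nx + N + 1) * (Q + N * c₂ * Q + D + 1) * Real.exp (-δ * t) *
        (QuantizedDoS.enorm2 (x 0) + QuantizedDoS.enorm2 (JL 0)) := by
    intro n q hn hn' hq v hv
    calc n * v ≤ n * ((Q + N * c₂ * Q + D + 1) * X * Real.exp (-δ * t)) := by
          gcongr
          exact hv.trans (by gcongr)
      _ ≤ (nx + N + 1) * ((Q + N * c₂ * Q + D + 1) * X * Real.exp (-δ * t)) := by gcongr
      _ = (nx + N + 1) * (Q + N * c₂ * Q + D + 1) * Real.exp (-δ * t) * X := by ring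
      _ ≤ _ := by gcongr
  have hNc : 0 ≤ N * c₂ * Q := by positivity
  have hnx : (0 : ℝ) ≤ nx := Nat.cast_nonneg _
  refine ⟨(QuantizedDoS.enorm2_le _).trans ?_, (QuantizedDoS.enorm2_le _).trans ?_,
    (QuantizedDoS.enorm2_le _).trans ?_⟩
  · rw [Fintype.card_fin]
    exact hfin nx Q hnx (by linarith) (by linarith) _ hx
  · exact hfin N _ hN (by linarith) (by linarith) _ hxhat
  · exact hfin N _ hN (by linarith) (by linarith) _ hJ'
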